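/- Let $\mathcal X$ be a finite non-empty set, let $r(x,y)\ge 0$ ($x,y\in\mathcal X$) be transition rates which are irreducible (any state can be reached from any other one via jumps of positive rate), let $T>0$, $\omega=2\pi/T$, and let $g:\mathbb R\times\mathcal X\times\mathcal X\to\mathbb R$ be bounded, measurable and $T$-periodic in its first argument. For $\lambda\in\mathbb R$ let $(X^\lambda_t)_{t\ge0}$ be the (time-inhomogeneous) Markov jump process on $\mathcal X$ with transition rates $r^\lambda(s,x,y)=e^{\lambda g(s,x,y)}r(x,y)$, and let $X=X^0$ be the unperturbed process; $\mathbb P_x$ is the law of the process started at $x$, and $\mathbb P_\nu=\sum_x\nu(x)\mathbb P_x$ for a probability distribution $\nu$. Then: (i) $X$ has a unique invariant distribution $\pi$, and for every $\lambda$ the discrete-time chain $(X^\lambda_{nT})_{n\ge 0}$ has a unique invariant distribution $\pi_\lambda$ (the law of $X^\lambda$ with initial distribution $\pi_\lambda$ is called the oscillatory steady state, OSS). (ii) For $v:\mathcal X\to\mathbb R$ the function $f_\lambda(t):=\mathbb E_{\pi_\lambda}[v(X^\lambda_t)]$, $t\ge0$, is $T$-periodic, i.e. $f_\lambda(t+T)=f_\lambda(t)$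 for all $t\ge0$, and it is integrable on $[0,T]$. (iii) For an integrable function $f$ on $[0,T]$ write $c_k(f)=\frac1T\int_0^T e^{-ik\omega t}f(t)\,dt$, $k\in\mathbb Z$. Let $\mathcal Lf(x)=\sum_y r(x,y)[f(y)-f(x)]$, $\langle f,h\rangle=\sum_x\pi(x)\overline{f(x)}h(x)$, $r^*(x,y)=\pi(y)r(y,x)/\pi(x)$, $$\psi_t(x)=\sum_{y}\bigl(r^*(x,y)\,g(t,y,x)-r(x,y)\,g(t,x,y)\bigr),\qquad \hat\psi_k(x)=c_k\bigl(t\mapsto\psi_t(x)\bigr).$$ Then for every $v:\mathcal X\to\mathbb R$ and every $k\in\mathbb Z$ the map $\lambda\mapsto c_k(f_\lambda)$ is differentiable at $\lambda=0$, the integrals below converge absolutely, and $$\partial_{\lambda=0}\,c_k(f_\lambda)=\int_0^\infty\bigl\langle e^{s(\mathcal L+ik\omega)}v,\hat\psi_k\bigr\rangle\,ds=\int_0^\infty e^{-ik\omega s}\,\mathbb E_\pi\bigl[v(X_s)\hat\psi_k(X_0)\bigr]\,ds .$$ -/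

import Mathlib

open MeasureTheory ProbabilityTheory Filter Topology
open scoped NNReal ENNReal BigOperators

namespace JumpLR

noncomputable section

/-- The generator associated with transition rates `q`, acting on real functions:
`L f (x) = ∑ y, q x y * (f y - f x)`. -/
def jumpGenerator {S : Type*} [Fintype S] (q : S → S → ℝ) (f : S → ℝ) (x : S) : ℝ :=
  ∑ y, q x y * (f y - f x)

/-- The Markov jump process with (possibly time-dependent) transition rates `R s x y`, started
at `x₀`, on the finite state space `S`: under the probability measure `P` the process `X` has
càdlàg paths (for the discrete topology of `S`), starts from `x₀` and solves the martingale
problem for the time-dependent generator `L_s f (x) = ∑ y, R s x y * (f y - f x)`.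
The filtration may be any one to which `X` is adapted; by the tower property this is the same as
asking for the natural filtration of `X`. -/
structure IsMarkovJumpProcess {S : Type*} [Fintype S] [MeasurableSpace S]
    (R : ℝ → S → S → ℝ) (x₀ : S)
    {Ω : Type*} [mΩ : MeasurableSpace Ω] (P : Measure Ω) (X : ℝ≥0 → Ω → S) : Prop where
  isProbabilityMeasure : IsProbabilityMeasure P
  measurable : ∀ t, Measurable (X t)
  rightContinuous : ∀ ω t, ∀ᶠ s in 𝓝[≥] t, X s ω = X t ω
  leftLimits : ∀ ω t, ∃ y, ∀ᶠ s in 𝓝[<] t, X s ω = y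
  start : ∀ᵐ ω ∂P, X 0 ω = x₀
  martingaleProblem : ∃ ℱ : Filtration ℝ≥0 mΩ, (∀ t, Measurable[ℱ t] (X t)) ∧
    ∀ f : S → ℝ, Martingale
      (fun (t : ℝ≥0) (ω : Ω) => f (X t ω) - f (X 0 ω) -
        ∫ s in (0 : ℝ)..(t : ℝ), jumpGenerator (R s) f (X s.toNNReal ω)) ℱ P

/-- Irreducibility: any state is reached from any other one through jumps of positive rate. -/
def Irreducible {S : Type*} (r : S → S → ℝ) : Prop :=
  ∀ x y, Relation.ReflTransGen (fun a b => 0 < r a b) x y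

/-- The perturbed rates `r^λ(s,x,y) = e^{λ g(s,x,y)} r(x,y)`. -/
def perturbedRate {S : Type*} (r : S → S → ℝ) (g : ℝ → S → S → ℝ) (lam : ℝ) :
    ℝ → S → S → ℝ :=
  fun s x y => Real.exp (lam * g s x y) * r x y

theorem perturbedRate_zero {S : Type*} (r : S → S → ℝ) (g : ℝ → S → S → ℝ) (s : ℝ) :
    perturbedRate r g 0 s = r := by
  funext x y
  simp [perturbedRate]

/-- The law `P_ν = ∑ x, ν(x) P_x` with initial distribution `ν`. -/
def lawFrom {S : Type*} [Fintype S] {Ω : Type*} [MeasurableSpace Ω]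
    (P : S → Measure Ω) (ν : S → ℝ) : Measure Ω :=
  ∑ x, ENNReal.ofReal (ν x) • P x

/-- The transition matrix `P_t(x,y) = P_x(X_t = y)`. -/
def transitionMatrix {S : Type*} {Ω : Type*} [MeasurableSpace Ω]
    (P : S → Measure Ω) (X : ℝ≥0 → Ω → S) (t : ℝ≥0) : Matrix S S ℝ :=
  Matrix.of fun x y => (P x).real {ω | X t ω = y}

/-- `ν` is a probability distribution, invariant for the stochastic matrix `Q`. -/
def IsInvariantDistribution {S : Type*} [Fintype S] (Q : Matrix S S ℝ) (ν : S → ℝ) : Prop :=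
  ν ∈ stdSimplex ℝ S ∧ Matrix.vecMul ν Q = ν

/-- The rates of the time-reversed stationary process, `r*(x,y) = π(y) r(y,x) / π(x)`. -/
def reversedRate {S : Type*} (r : S → S → ℝ) (π : S → ℝ) (x y : S) : ℝ :=
  π y * r y x / π x

/-- `ψ_t(x) = ∑ y, (r*(x,y) g(t,y,x) - r(x,y) g(t,x,y))`. -/
def psi {S : Type*} [Fintype S] (r : S → S → ℝ) (g : ℝ → S → S → ℝ) (π : S → ℝ)
    (t : ℝ) (x : S) : ℝ :=
  ∑ y, (reversedRate r π x y * g t y x - r x y * g t x y)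

/-- The `k`-th Fourier coefficient `c_k(f) = T⁻¹ ∫_0^T e^{-ikωt} f(t) dt`, `ω = 2π / T`. -/
def fourierCoefficient (T : ℝ) (k : ℤ) (f : ℝ → ℝ) : ℂ :=
  (1 / (T : ℂ)) * ∫ t in (0 : ℝ)..T,
    Complex.exp (-Complex.I * k * ((2 * Real.pi / T : ℝ) : ℂ) * t) * (f t : ℂ)

/-- The `k`-th Fourier coefficient `ψ̂_k(x)` of `t ↦ ψ_t(x)`. -/
def psiHat {S : Type*} [Fintype S] (r : S → S → ℝ) (g : ℝ → S → S → ℝ) (π : S → ℝ)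
    (T : ℝ) (k : ℤ) (x : S) : ℂ :=
  fourierCoefficient T k (fun t => psi r g π t x)

/-- The mean `f(t) = E_ν[v(X_t)]` of the observable `v` at time `t ≥ 0`. -/
def meanObservable {S : Type*} [Fintype S] {Ω : Type*} [MeasurableSpace Ω]
    (P : S → Measure Ω) (X : ℝ≥0 → Ω → S) (ν : S → ℝ) (v : S → ℝ) (t : ℝ≥0) : ℝ :=
  ∫ ω, v (X t ω) ∂(lawFrom P ν)

/-- The generator of the unperturbed process as an operator on complex functions. -/
def generatorMatrix {S : Type*} [Fintype S] [DecidableEq S] (r : S → S → ℝ) : Matrix S S ℂ :=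
  Matrix.of fun x y => (r x y : ℂ) - if x = y then ∑ z, (r x z : ℂ) else 0

theorem generatorMatrix_mulVec {S : Type*} [Fintype S] [DecidableEq S] (r : S → S → ℝ)
    (f : S → ℂ) (x : S) :
    (generatorMatrix r).mulVec f x = ∑ y, (r x y : ℂ) * (f y - f x) := by
  simp [generatorMatrix, Matrix.mulVec, dotProduct, sub_mul, mul_sub, Finset.sum_sub_distrib,
    Finset.sum_mul]

/-- The scalar product of `L²(π)`, antilinear in the first entry. -/
def innerPi {S : Type*} [Fintype S] (π : S → ℝ) (f h : S → ℂ) : ℂ :=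
  ∑ x, (π x : ℂ) * (starRingEnd ℂ (f x)) * h x

/-- `⟨e^{s(L + ikω)} v, ψ̂_k⟩` in `L²(π)`, `ω = 2π / T`. -/
def semigroupPairing {S : Type*} [Fintype S] [DecidableEq S] (r : S → S → ℝ)
    (g : ℝ → S → S → ℝ) (π : S → ℝ) (T : ℝ) (k : ℤ) (v : S → ℝ) (s : ℝ) : ℂ :=
  innerPi π
    ((NormedSpace.exp ((s : ℂ) • (generatorMatrix r +
      (Complex.I * k * ((2 * Real.pi / T : ℝ) : ℂ)) • (1 : Matrix S S ℂ)))).mulVec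
        (fun x => (v x : ℂ)))
    (psiHat r g π T k)

/-- `e^{-ikωs} E_π[v(X_s) ψ̂_k(X_0)]`, `ω = 2π / T`. -/
def correlation {S : Type*} [Fintype S] {Ω : Type*} [MeasurableSpace Ω]
    (P : S → Measure Ω) (X : ℝ≥0 → Ω → S) (r : S → S → ℝ) (g : ℝ → S → S → ℝ) (π : S → ℝ)
    (T : ℝ) (k : ℤ) (v : S → ℝ) (s : ℝ) : ℂ :=
  Complex.exp (-Complex.I * k * ((2 * Real.pi / T : ℝ) : ℂ) * s) *
    ∫ ω, (v (X s.toNNReal ω) : ℂ) * psiHat r g π T k (X 0 ω) ∂(lawFrom P π)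

end

end JumpLR

/-!
The law `μ` of a jump process with bounded rates solves the forward equation
`μ' = netFlow (r^λ) μ`, and irreducibility makes all its weights positive at positive times. The
transition matrices over a period are therefore strict contractions for the total variation
distance, which yields the invariant distributions, their uniqueness and exponential mixing.

For the linear response let `z = -ikω` and let `w = ∫₀^∞ e^{s(L + z)} (v - E_π v) ds`, which
solves `(L + z) w = -(v - E_π v)`. Integrating `d/dt (e^{zt} E_{μ_t} w)` over a period, where `μ`
is the oscillatory steady state, the boundary terms cancel and the forward equation leaves
`∫₀^T e^{zt} E_{μ_t} v dt = const + ∫₀^T e^{zt} (E_{netFlow (r^λ - r) μ_t} w) dt`. As `λ → 0` the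
oscillatory steady state tends to `π` and `(r^λ - r) / λ` to `r g`, so that dominated convergence
gives the derivative; it is the pairing of `w` with `ψ̂_k`, because `π ψ_t = netFlow (r g_t) π`.
-/

namespace JumpLR

section Calculus

theorem intervalIntegrable_of_norm_le {E : Type*} [NormedAddCommGroup E] {f : ℝ → E} {C : ℝ}
    (hf : AEStronglyMeasurable f) (hC : ∀ t, ‖f t‖ ≤ C) (a b : ℝ) :
    IntervalIntegrable f volume a b :=
  (intervalIntegrable_const (c := C)).mono_fun hf.restrict
    (.of_forall fun t => (hC t).trans (le_abs_self C))

theorem integral_deriv_mul_add_mul_deriv {u u' h h' : ℝ → ℝ} {a b : ℝ}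
    (hu' : IntervalIntegrable u' volume a b)
    (hu : ∀ t ∈ Set.uIcc a b, u t = u a + ∫ s in a..t, u' s)
    (hh : ∀ t, HasDerivAt h (h' t) t) (hh' : Continuous h') :
    ∫ t in a..b, (u' t * h t + u t * h' t) = u b * h b - u a * h a := by
  let U : ℝ → ℝ := fun t => u a + ∫ s in a..t, u' s
  have hU : AbsolutelyContinuousOnInterval U a b :=
    ((LipschitzWith.const (u a)).lipschitzOnWith.absolutelyContinuousOnInterval).fun_add
      (hu'.absolutelyContinuousOnInterval_intervalIntegral Set.left_mem_uIcc)
  have hderiv : deriv h = h' := funext fun t => (hh t).deriv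
  have hh_ac : AbsolutelyContinuousOnInterval h a b :=
    (contDiff_one_iff_deriv.2
      ⟨fun t => (hh t).differentiableAt, hderiv ▸ hh'⟩).contDiffOn.absolutelyContinuousOnInterval
  have hua : u a = U a := hu a Set.left_mem_uIcc
  have hub : u b = U b := hu b Set.right_mem_uIcc
  rw [hua, hub, ← hU.integral_deriv_mul_eq_sub hh_ac, hderiv]
  refine intervalIntegral.integral_congr_ae ?_
  filter_upwards [hu'.ae_hasDerivAt_integral] with t ht ht_mem
  have ht_mem' := Set.uIoc_subset_uIcc ht_mem
  rw [((ht ht_mem' a Set.left_mem_uIcc).const_add (u a)).deriv, hu t ht_mem']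

theorem integral_deriv_mul_add_mul_deriv_complex {u u' : ℝ → ℝ} {h h' : ℝ → ℂ} {a b : ℝ}
    (hu' : IntervalIntegrable u' volume a b)
    (hu : ∀ t ∈ Set.uIcc a b, u t = u a + ∫ s in a..t, u' s)
    (hh : ∀ t, HasDerivAt h (h' t) t) (hh' : Continuous h') :
    IntervalIntegrable (fun t => (u' t : ℂ) * h t + u t * h' t) volume a b ∧
      ∫ t in a..b, ((u' t : ℂ) * h t + u t * h' t) = u b * h b - u a * h a := by
  have hu_cont : ContinuousOn u (Set.uIcc a b) :=
    (continuousOn_const.add (intervalIntegral.continuousOn_primitive_interval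
      ((intervalIntegrable_iff' (f := u')).1 hu'))).congr hu
  have hh_cont : Continuous h := continuous_iff_continuousAt.2 fun t => (hh t).continuousAt
  have hint : IntervalIntegrable (fun t => (u' t : ℂ) * h t + u t * h' t) volume a b :=
    (IntervalIntegrable.mul_continuousOn (f := fun t => (u' t : ℂ)) ⟨hu'.1.ofReal, hu'.2.ofReal⟩
      hh_cont.continuousOn).add
      ((Complex.continuous_ofReal.comp_continuousOn hu_cont).mul
        hh'.continuousOn).intervalIntegrable
  refine ⟨hint, Complex.ext ?_ ?_⟩
  · rw [← Complex.reCLM_apply, ← Complex.reCLM.intervalIntegral_comp_comm hint]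
    simpa using integral_deriv_mul_add_mul_deriv hu' hu
      (fun t => Complex.reCLM.hasFDerivAt.comp_hasDerivAt t (hh t))
      (Complex.continuous_re.comp hh')
  · rw [← Complex.imCLM_apply, ← Complex.imCLM.intervalIntegral_comp_comm hint]
    simpa using integral_deriv_mul_add_mul_deriv hu' hu
      (fun t => Complex.imCLM.hasFDerivAt.comp_hasDerivAt t (hh t))
      (Complex.continuous_im.comp hh')

theorem hasDerivAt_mul_sub_of_tendsto {u v : ℝ → ℝ} {u' c x : ℝ} (hu : HasDerivAt u u' x)
    (hv : Tendsto v (𝓝 x) (𝓝 c)) : HasDerivAt (fun y => v y * (u y - u x)) (c * u') x := by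
  rw [hasDerivAt_iff_tendsto_slope] at hu ⊢
  refine ((hv.mono_left nhdsWithin_le_nhds).mul hu).congr fun y => ?_
  simp only [slope_def_field, sub_self, mul_zero, sub_zero, mul_div_assoc]

theorem hasDerivAt_intervalIntegral_of_norm_sub_le {E : Type*} [NormedAddCommGroup E]
    [NormedSpace ℝ E] {F : ℝ → ℝ → E} {F' : ℝ → E} {x a b B : ℝ}
    (hF : ∀ y, IntervalIntegrable (F y) volume a b)
    (hB : ∀ᶠ y in 𝓝 x, ∀ t ∈ Set.uIoc a b, ‖F y t - F x t‖ ≤ B * |y - x|)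
    (hF' : ∀ t ∈ Set.uIoc a b, HasDerivAt (fun y => F y t) (F' t) x) :
    HasDerivAt (fun y => ∫ t in a..b, F y t) (∫ t in a..b, F' t) x := by
  have hslope : ∀ y, slope (fun y => ∫ t in a..b, F y t) x y =
      ∫ t in a..b, slope (fun y => F y t) x y := fun y => by
    simp only [slope_def_module]
    rw [intervalIntegral.integral_smul, intervalIntegral.integral_sub (hF y) (hF x)]
  simp only [hasDerivAt_iff_tendsto_slope] at hF' ⊢
  refine Tendsto.congr (fun y => (hslope y).symm) ?_
  refine intervalIntegral.tendsto_integral_filter_of_dominated_convergence (fun _ => B)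
    (.of_forall fun y => ?_) ?_ intervalIntegrable_const (.of_forall hF')
  · simp only [slope_def_module]
    exact (((hF y).sub (hF x)).smul (y - x)⁻¹).def'.aestronglyMeasurable
  · filter_upwards [hB.filter_mono nhdsWithin_le_nhds, self_mem_nhdsWithin] with y hy hne
    refine .of_forall fun t ht => ?_
    rw [slope_def_module, norm_smul, norm_inv, Real.norm_eq_abs, inv_mul_le_iff₀']
    · exact hy t ht
    · exact abs_pos.2 (sub_ne_zero.2 hne)

theorem le_gronwallBound_of_le_integral {u : ℝ → ℝ} {δ K ε a b : ℝ} (hK : 0 ≤ K)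
    (hu : ContinuousOn u (Set.Icc a b))
    (h : ∀ t ∈ Set.Icc a b, u t ≤ δ + ∫ s in a..t, (K * u s + ε)) :
    ∀ t ∈ Set.Icc a b, u t ≤ gronwallBound δ K ε (t - a) := by
  have hcont : ContinuousOn (fun s => K * u s + ε) (Set.Icc a b) := by fun_prop
  have hderiv : ∀ t ∈ Set.Ico a b, HasDerivWithinAt (fun t => δ + ∫ s in a..t, (K * u s + ε))
      (K * u t + ε) (Set.Ici t) t := fun t ht => by
    refine (intervalIntegral.integral_hasDerivWithinAt_right (t := Set.Ioi t)
      ((hcont.mono (Set.Icc_subset_Icc_right ht.2.le)).intervalIntegrable_of_Icc ht.1)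
      ⟨Set.Ioo t b, Ioo_mem_nhdsGT ht.2, ?_⟩ ?_).const_add δ
    · exact (hcont.mono fun s hs => ⟨ht.1.trans hs.1.le, hs.2.le⟩).aestronglyMeasurable
        measurableSet_Ioo
    · exact (hcont t (Set.Ico_subset_Icc_self ht)).mono_of_mem_nhdsWithin
        (Icc_mem_nhdsGT_of_mem ht)
  intro t ht
  have hprim : ContinuousOn (fun t => δ + ∫ s in a..t, (K * u s + ε)) (Set.Icc a b) := by
    rw [← Set.uIcc_of_le (ht.1.trans ht.2)] at hcont ⊢
    exact continuousOn_const.add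
      (intervalIntegral.continuousOn_primitive_interval (hcont.integrableOn_compact isCompact_uIcc))
  refine (h t ht).trans (le_gronwallBound_of_liminf_deriv_right_le hprim
    (fun t ht _ => (hderiv t ht).liminf_right_slope_le) (by simp) (fun t ht => ?_) t ht)
  have := h t (Set.Ico_subset_Icc_self ht)
  gcongr

theorem exists_le_mul_exp_neg {φ : ℝ → ℝ} {B ρ : ℝ} (hφ : ∀ t, 0 ≤ t → 0 ≤ φ t)
    (hB : ∀ t, 0 ≤ t → φ t ≤ B) (hρ : ρ < 1) (hstep : ∀ t, 0 ≤ t → φ (t + 1) ≤ ρ * φ t) :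
    ∃ K c : ℝ, 0 < c ∧ ∀ t, 0 ≤ t → φ t ≤ K * Real.exp (-c * t) := by
  obtain ⟨σ, hρσ, hσ⟩ := exists_between (max_lt hρ one_pos)
  obtain ⟨hρσ, hσ0⟩ := max_lt_iff.1 hρσ
  have hiter : ∀ (n : ℕ) (t : ℝ), 0 ≤ t → φ (t + n) ≤ σ ^ n * B := fun n => by
    induction n with
    | zero => simpa using hB
    | succ n ih =>
      intro t ht
      calc φ (t + (n + 1 : ℕ)) = φ (t + n + 1) := by push_cast; ring_nf
        _ ≤ ρ * φ (t + n) := hstep _ (by positivity)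
        _ ≤ σ * (σ ^ n * B) := by
          gcongr
          · exact hφ _ (by positivity)
          · exact ih t ht
        _ = σ ^ (n + 1) * B := by ring
  refine ⟨B / σ, -Real.log σ, neg_pos.2 (Real.log_neg hσ0 hσ), fun t ht => ?_⟩
  have hB0 : 0 ≤ B := (hφ t ht).trans (hB t ht)
  have hfloor : σ ^ ⌊t⌋₊ ≤ σ⁻¹ * Real.exp (Real.log σ * t) := by
    rw [← Real.rpow_natCast, ← Real.rpow_def_of_pos hσ0, ← Real.rpow_neg_one, ← Real.rpow_add hσ0]
    exact Real.rpow_le_rpow_of_exponent_ge hσ0 hσ.le (by linarith [Nat.lt_floor_add_one t])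
  calc φ t = φ (t - ⌊t⌋₊ + ⌊t⌋₊) := by rw [sub_add_cancel]
    _ ≤ σ ^ ⌊t⌋₊ * B := hiter _ _ (sub_nonneg.2 (Nat.floor_le ht))
    _ ≤ σ⁻¹ * Real.exp (Real.log σ * t) * B := by gcongr
    _ = B / σ * Real.exp (- -Real.log σ * t) := by rw [neg_neg]; ring

end Calculus

section MatrixExponential

open scoped Matrix.Norms.Operator

variable {S : Type*} [Fintype S] [DecidableEq S]

theorem hasDerivAt_exp_smul_mulVec (A : Matrix S S ℂ) (f : S → ℂ) (s : ℝ) :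
    HasDerivAt (fun s : ℝ => (NormedSpace.exp ((s : ℂ) • A)).mulVec f)
      (A.mulVec ((NormedSpace.exp ((s : ℂ) • A)).mulVec f)) s := by
  have hexp : HasDerivAt (fun u : ℂ => NormedSpace.exp (u • A))
      (A * NormedSpace.exp ((s : ℂ) • A)) s := hasDerivAt_exp_smul_const' A (s : ℂ)
  let L : Matrix S S ℂ →ₗ[ℂ] S → ℂ := LinearMap.applyₗ f ∘ₗ Matrix.toLin'.toLinearMap
  have := (L.toContinuousLinearMap.hasFDerivAt.comp_hasDerivAt (s : ℂ) hexp).scomp s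
    Complex.ofRealCLM.hasDerivAt
  rw [Complex.ofRealCLM_apply, Complex.ofReal_one, one_smul] at this
  rw [Matrix.mulVec_mulVec]
  exact this

theorem continuous_exp_smul_mulVec (A : Matrix S S ℂ) (f : S → ℂ) :
    Continuous fun s : ℝ => (NormedSpace.exp ((s : ℂ) • A)).mulVec f :=
  continuous_iff_continuousAt.2 fun s => (hasDerivAt_exp_smul_mulVec A f s).continuousAt

theorem integrableOn_exp_smul_mulVec {A : Matrix S S ℂ} {f : S → ℂ} {K c : ℝ} (hc : 0 < c)
    (hdecay : ∀ s : ℝ, 0 ≤ s → ‖(NormedSpace.exp ((s : ℂ) • A)).mulVec f‖ ≤ K * Real.exp (-c * s)) :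
    IntegrableOn (fun s : ℝ => (NormedSpace.exp ((s : ℂ) • A)).mulVec f) (Set.Ioi 0) :=
  Integrable.mono' ((exp_neg_integrableOn_Ioi 0 hc).const_mul K)
    (continuous_exp_smul_mulVec A f).aestronglyMeasurable
    ((ae_restrict_mem measurableSet_Ioi).mono fun s hs => hdecay s (le_of_lt hs))

theorem mulVec_integral_exp_smul_mulVec {A : Matrix S S ℂ} {f : S → ℂ} {K c : ℝ} (hc : 0 < c)
    (hdecay : ∀ s : ℝ, 0 ≤ s → ‖(NormedSpace.exp ((s : ℂ) • A)).mulVec f‖ ≤ K * Real.exp (-c * s)) :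
    A.mulVec (∫ s in Set.Ioi (0 : ℝ), (NormedSpace.exp ((s : ℂ) • A)).mulVec f) = -f := by
  let L : (S → ℂ) →L[ℂ] S → ℂ := (Matrix.mulVecLin A).toContinuousLinearMap
  have hint := integrableOn_exp_smul_mulVec hc hdecay
  have hlim : Tendsto (fun s : ℝ => (NormedSpace.exp ((s : ℂ) • A)).mulVec f) atTop (𝓝 0) := by
    refine squeeze_zero_norm' (eventually_atTop.2 ⟨0, hdecay⟩) ?_
    have := (Real.tendsto_exp_atBot.comp (tendsto_id.const_mul_atTop_of_neg (neg_neg_of_pos hc)))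
    simpa using this.const_mul K
  have hftc := integral_Ioi_of_hasDerivAt_of_tendsto'
    (fun s _ => hasDerivAt_exp_smul_mulVec A f s) (L.integrable_comp hint) hlim
  calc A.mulVec _ = L (∫ s in Set.Ioi (0 : ℝ), (NormedSpace.exp ((s : ℂ) • A)).mulVec f) := rfl
    _ = _ := (L.integral_comp_comm hint).symm
    _ = -f := by simpa [L] using hftc

end MatrixExponential

section StochasticMatrix

variable {S : Type*} [Fintype S] {Q : Matrix S S ℝ}

theorem sum_abs_of_mem_stdSimplex {m : S → ℝ} (hm : m ∈ stdSimplex ℝ S) : ∑ x, |m x| = 1 := by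
  simp only [abs_of_nonneg (hm.1 _), hm.2]

theorem vecMul_mem_stdSimplex (hQ : ∀ x, Q x ∈ stdSimplex ℝ S) {m : S → ℝ}
    (hm : m ∈ stdSimplex ℝ S) : Matrix.vecMul m Q ∈ stdSimplex ℝ S := by
  rw [Matrix.vecMul_eq_sum]
  exact (convex_stdSimplex ℝ S).sum_mem (fun x _ => hm.1 x) hm.2 fun x _ => hQ x

theorem sum_vecMul_eq_sum (hQ : ∀ x, Q x ∈ stdSimplex ℝ S) (m : S → ℝ) :
    ∑ y, Matrix.vecMul m Q y = ∑ x, m x := by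
  simp only [Matrix.vecMul, dotProduct]
  rw [Finset.sum_comm]
  exact Finset.sum_congr rfl fun x _ => by rw [← Finset.mul_sum, (hQ x).2, mul_one]

-- Subtracting `ε` from every entry of `Q` does not change `m Q`, since `m` has mass zero.
theorem sum_abs_vecMul_le (hQ : ∀ x, Q x ∈ stdSimplex ℝ S) {ε : ℝ} (hε : ∀ x y, ε ≤ Q x y)
    {m : S → ℝ} (hm : ∑ x, m x = 0) :
    ∑ y, |Matrix.vecMul m Q y| ≤ (1 - Fintype.card S * ε) * ∑ x, |m x| := by
  have hsub : ∀ y, Matrix.vecMul m Q y = ∑ x, m x * (Q x y - ε) := fun y => by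
    simp only [mul_sub, Finset.sum_sub_distrib, ← Finset.sum_mul, hm, zero_mul, sub_zero]
    rfl
  calc ∑ y, |Matrix.vecMul m Q y| ≤ ∑ y, ∑ x, |m x| * (Q x y - ε) :=
        Finset.sum_le_sum fun y _ => by
          rw [hsub]
          refine (Finset.abs_sum_le_sum_abs _ _).trans_eq (Finset.sum_congr rfl fun x _ => ?_)
          rw [abs_mul, abs_of_nonneg (sub_nonneg.2 (hε x y))]
    _ = ∑ x, |m x| * ∑ y, (Q x y - ε) := by
        rw [Finset.sum_comm]
        simp only [Finset.mul_sum]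
    _ = (1 - Fintype.card S * ε) * ∑ x, |m x| := by
        simp only [Finset.sum_sub_distrib, (hQ _).2, Finset.sum_const, Finset.card_univ,
          nsmul_eq_mul]
        rw [← Finset.sum_mul, mul_comm]

theorem exists_sum_abs_vecMul_le_of_pos (hQ : ∀ x, Q x ∈ stdSimplex ℝ S)
    (hpos : ∀ x y, 0 < Q x y) :
    ∃ ρ < 1, ∀ m : S → ℝ, ∑ x, m x = 0 → ∑ y, |Matrix.vecMul m Q y| ≤ ρ * ∑ x, |m x| := by
  cases isEmpty_or_nonempty S with
  | inl _ => exact ⟨0, one_pos, fun m _ => by simp⟩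
  | inr _ =>
    obtain ⟨z, hz⟩ := Finite.exists_min fun z : S × S => Q z.1 z.2
    have hcard : 0 < (Fintype.card S : ℝ) := by exact_mod_cast Fintype.card_pos
    exact ⟨1 - Fintype.card S * Q z.1 z.2, sub_lt_self _ (mul_pos hcard (hpos _ _)),
      fun m hm => sum_abs_vecMul_le hQ (fun x y => hz (x, y)) hm⟩

theorem vecMul_abs_of_vecMul_eq (hQ : ∀ x, Q x ∈ stdSimplex ℝ S) {m : S → ℝ}
    (hm : Matrix.vecMul m Q = m) :
    Matrix.vecMul (fun x => |m x|) Q = fun x => |m x| := by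
  have hle : ∀ y, |m y| ≤ Matrix.vecMul (fun x => |m x|) Q y := fun y => by
    conv_lhs => rw [← hm]
    refine (Finset.abs_sum_le_sum_abs _ _).trans_eq (Finset.sum_congr rfl fun x _ => ?_)
    rw [abs_mul, abs_of_nonneg ((hQ x).1 y)]
  have hsum := (sum_vecMul_eq_sum hQ fun x => |m x|).symm
  exact funext fun y =>
    ((Finset.sum_eq_sum_iff_of_le fun y _ => hle y).1 hsum y (Finset.mem_univ y)).symm

-- `Q - 1` kills the constants, so it also has a nonzero left null vector `m`; normalize `|m|`.
theorem exists_isInvariantDistribution [Nonempty S] (hQ : ∀ x, Q x ∈ stdSimplex ℝ S) :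
    ∃ ν, IsInvariantDistribution Q ν := by
  classical
  have hdet : (Q - 1).det = 0 := by
    refine Matrix.exists_mulVec_eq_zero_iff.1 ⟨fun _ => 1,
      fun h => one_ne_zero (congrFun h (Classical.arbitrary S)), funext fun x => ?_⟩
    rw [Matrix.sub_mulVec, Matrix.one_mulVec]
    simpa [Matrix.mulVec, dotProduct, sub_eq_zero] using (hQ x).2
  obtain ⟨m, hm0, hm⟩ := Matrix.exists_vecMul_eq_zero_iff.2 hdet
  rw [Matrix.vecMul_sub, Matrix.vecMul_one, sub_eq_zero] at hm
  have hpos : 0 < ∑ x, |m x| := by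
    obtain ⟨x, hx⟩ := Function.ne_iff.1 hm0
    exact Finset.sum_pos' (fun x _ => abs_nonneg _) ⟨x, Finset.mem_univ x, abs_pos.2 hx⟩
  refine ⟨(∑ x, |m x|)⁻¹ • fun x => |m x|, ⟨fun x => ?_, ?_⟩, ?_⟩
  · simp only [Pi.smul_apply, smul_eq_mul]
    positivity
  · simp only [Pi.smul_apply, smul_eq_mul, ← Finset.mul_sum]
    exact inv_mul_cancel₀ hpos.ne'
  · rw [Matrix.smul_vecMul, vecMul_abs_of_vecMul_eq hQ hm]

theorem IsInvariantDistribution.eq_of_pos (hQ : ∀ x, Q x ∈ stdSimplex ℝ S)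
    (hpos : ∀ x y, 0 < Q x y) {ν ν' : S → ℝ} (hν : IsInvariantDistribution Q ν)
    (hν' : IsInvariantDistribution Q ν') : ν = ν' := by
  obtain ⟨ρ, hρ, hcontr⟩ := exists_sum_abs_vecMul_le_of_pos hQ hpos
  have hle := hcontr (ν - ν') (by simp [Finset.sum_sub_distrib, hν.1.2, hν'.1.2])
  rw [Matrix.sub_vecMul, hν.2, hν'.2] at hle
  have hzero : ∑ x, |(ν - ν') x| ≤ 0 := by nlinarith
  funext x
  exact sub_eq_zero.1 (abs_nonpos_iff.1
    ((Finset.single_le_sum (fun x _ => abs_nonneg ((ν - ν') x)) (Finset.mem_univ x)).trans hzero))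

theorem existsUnique_isInvariantDistribution [Nonempty S] (hQ : ∀ x, Q x ∈ stdSimplex ℝ S)
    (hpos : ∀ x y, 0 < Q x y) : ∃! ν, IsInvariantDistribution Q ν :=
  existsUnique_of_exists_of_unique (exists_isInvariantDistribution hQ)
    fun _ _ hν hν' => hν.eq_of_pos hQ hpos hν'

end StochasticMatrix

section NetFlow

variable {S : Type*} [Fintype S]

/-- The net probability flow into `y` of the mass distribution `m` under the rates `q`, that is
the adjoint of the generator of `q` applied to `m`. -/
def netFlow (q : S → S → ℝ) (m : S → ℝ) (y : S) : ℝ :=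
  ∑ x, (m x * q x y - m y * q y x)

/-- The mean of the complex observable `f` under the mass distribution `m`. -/
def expectation (m : S → ℝ) (f : S → ℂ) : ℂ :=
  ∑ x, (m x : ℂ) * f x

theorem expectation_add (m : S → ℝ) (f h : S → ℂ) :
    expectation m (f + h) = expectation m f + expectation m h := by
  simp [expectation, mul_add, Finset.sum_add_distrib]

theorem expectation_sub_left (m n : S → ℝ) (f : S → ℂ) :
    expectation (m - n) f = expectation m f - expectation n f := by
  simp [expectation, sub_mul, Finset.sum_sub_distrib]

theorem expectation_smul (m : S → ℝ) (c : ℂ) (f : S → ℂ) :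
    expectation m (c • f) = c * expectation m f := by
  simp [expectation, Finset.mul_sum, mul_left_comm]

theorem expectation_generatorMatrix_mulVec [DecidableEq S] (q : S → S → ℝ) (m : S → ℝ)
    (f : S → ℂ) :
    expectation m ((generatorMatrix q).mulVec f) = expectation (netFlow q m) f := by
  simp only [expectation, generatorMatrix_mulVec, netFlow, Finset.mul_sum, Complex.ofReal_sum,
    Complex.ofReal_sub, Complex.ofReal_mul, Finset.sum_mul, mul_sub, sub_mul,
    Finset.sum_sub_distrib, mul_assoc]
  rw [Finset.sum_comm]

theorem intervalIntegrable_expectation {n : ℝ → S → ℝ} {a b : ℝ}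
    (hn : ∀ x, IntervalIntegrable (fun s => n s x) volume a b) (f : S → ℂ) :
    IntervalIntegrable (fun s => expectation (n s) f) volume a b := by
  have hterm : ∀ x, IntervalIntegrable (fun s => (n s x : ℂ) * f x) volume a b := fun x =>
    ⟨(hn x).1.ofReal.mul_const (f x), (hn x).2.ofReal.mul_const (f x)⟩
  simpa only [expectation, Finset.sum_fn] using
    IntervalIntegrable.sum Finset.univ fun x _ => hterm x

theorem norm_expectation_le (m : S → ℝ) (f : S → ℂ) :
    ‖expectation m f‖ ≤ (∑ x, |m x|) * ‖f‖ := by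
  rw [Finset.sum_mul]
  refine (norm_sum_le _ _).trans (Finset.sum_le_sum fun x _ => ?_)
  rw [norm_mul, Complex.norm_real, Real.norm_eq_abs]
  gcongr
  exact norm_le_pi_norm f x

theorem netFlow_sub_netFlow (q r : S → S → ℝ) (m n : S → ℝ) (y : S) :
    netFlow q m y - netFlow r n y = netFlow q (m - n) y + netFlow (q - r) n y := by
  simp only [netFlow, ← Finset.sum_sub_distrib, ← Finset.sum_add_distrib, Pi.sub_apply]
  exact Finset.sum_congr rfl fun x _ => by ring

theorem netFlow_sub_left (q r : S → S → ℝ) (m : S → ℝ) :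
    netFlow (q - r) m = netFlow q m - netFlow r m := by
  funext y
  simp only [netFlow, ← Finset.sum_sub_distrib, Pi.sub_apply]
  exact Finset.sum_congr rfl fun x _ => by ring

theorem netFlow_vecMul (q : S → S → ℝ) (m : S → ℝ) (Q : Matrix S S ℝ) (y : S) :
    netFlow q (Matrix.vecMul m Q) y = ∑ x, m x * netFlow q (Q x) y := by
  simp only [netFlow, Matrix.vecMul, dotProduct, Finset.mul_sum, Finset.sum_mul,
    Finset.sum_sub_distrib, mul_sub]
  congr 1 <;> rw [Finset.sum_comm] <;> simp only [mul_assoc]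

theorem hasDerivAt_netFlow_sub {q : ℝ → S → S → ℝ} {q' : S → S → ℝ} {m : ℝ → S → ℝ} {n : S → ℝ}
    {a : ℝ} (hq : ∀ x y, HasDerivAt (fun lam => q lam x y) (q' x y) a)
    (hm : ∀ x, Tendsto (fun lam => m lam x) (𝓝 a) (𝓝 (n x))) (y : S) :
    HasDerivAt (fun lam => netFlow (q lam - q a) (m lam) y) (netFlow q' n y) a :=
  HasDerivAt.fun_sum fun x _ => (hasDerivAt_mul_sub_of_tendsto (hq x y) (hm x)).sub
    (hasDerivAt_mul_sub_of_tendsto (hq y x) (hm y))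

theorem sum_abs_netFlow_le {q : S → S → ℝ} {C : ℝ} (hC : ∀ x y, |q x y| ≤ C) (m : S → ℝ) :
    ∑ y, |netFlow q m y| ≤ 2 * Fintype.card S * C * ∑ x, |m x| :=
  calc ∑ y, |netFlow q m y| ≤ ∑ y, ∑ x, (|m x| * C + |m y| * C) := by
        refine Finset.sum_le_sum fun y _ => (Finset.abs_sum_le_sum_abs _ _).trans
          (Finset.sum_le_sum fun x _ => (abs_sub _ _).trans ?_)
        rw [abs_mul, abs_mul]
        gcongr <;> exact hC _ _
    _ = 2 * Fintype.card S * C * ∑ x, |m x| := by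
        simp only [Finset.sum_add_distrib, ← Finset.sum_mul, Finset.sum_const, Finset.card_univ,
          nsmul_eq_mul, ← Finset.mul_sum]
        ring

theorem sum_abs_netFlow_sub_netFlow_le {q r : S → S → ℝ} {C η : ℝ} (hC : ∀ x y, |q x y| ≤ C)
    (hη : ∀ x y, |q x y - r x y| ≤ η) (m n : S → ℝ) :
    ∑ y, |netFlow q m y - netFlow r n y| ≤
      2 * Fintype.card S * C * ∑ y, |m y - n y| + 2 * Fintype.card S * η * ∑ y, |n y| :=
  calc ∑ y, |netFlow q m y - netFlow r n y|
      ≤ ∑ y, (|netFlow q (m - n) y| + |netFlow (q - r) n y|) :=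
        Finset.sum_le_sum fun y _ => netFlow_sub_netFlow q .. ▸ abs_add_le _ _
    _ ≤ _ := by
        rw [Finset.sum_add_distrib]
        exact add_le_add (sum_abs_netFlow_le hC _) (sum_abs_netFlow_le hη _)

theorem mul_rate_le_netFlow_add {q : S → S → ℝ} {C : ℝ} (hq : ∀ x y, 0 ≤ q x y)
    (hC : ∀ x y, q x y ≤ C) {m : S → ℝ} (hm : ∀ x, 0 ≤ m x) (x y : S) :
    m x * q x y ≤ netFlow q m y + C * Fintype.card S * m y := by
  have hin : m x * q x y ≤ ∑ z, m z * q z y :=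
    Finset.single_le_sum (f := fun z => m z * q z y) (fun z _ => mul_nonneg (hm z) (hq z y))
      (Finset.mem_univ x)
  have hout : ∑ z, m y * q y z ≤ C * Fintype.card S * m y :=
    calc ∑ z, m y * q y z ≤ ∑ _z : S, m y * C :=
          Finset.sum_le_sum fun z _ => mul_le_mul_of_nonneg_left (hC y z) (hm y)
      _ = C * Fintype.card S * m y := by
          rw [Finset.sum_const, Finset.card_univ, nsmul_eq_mul]
          ring
  rw [netFlow, Finset.sum_sub_distrib]
  linarith

end NetFlow

section ForwardEquation

variable {S : Type*}

/-- Time-dependent transition rates which are measurable in time, nonnegative and bounded. -/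
structure IsBoundedRate (q : ℝ → S → S → ℝ) : Prop where
  measurable : ∀ x y, Measurable fun s => q s x y
  nonneg : ∀ s x y, 0 ≤ q s x y
  bddAbove : ∃ C, ∀ s x y, q s x y ≤ C

variable [Fintype S]

/-- A flow of probability distributions solving, for times `t ≥ 0`, the forward equation
`∂ₜ μ t = netFlow (q t) (μ t)` in integral form. Values at negative times are unconstrained, apart
from measurability. -/
structure IsForwardSolution (q : ℝ → S → S → ℝ) (μ : ℝ → S → ℝ) : Prop where
  mem : ∀ t, μ t ∈ stdSimplex ℝ S
  measurable : ∀ y, Measurable fun t => μ t y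
  eq_integral : ∀ t, 0 ≤ t → ∀ y, μ t y = μ 0 y + ∫ s in (0 : ℝ)..t, netFlow (q s) (μ s) y

namespace IsForwardSolution

variable {q r : ℝ → S → S → ℝ} {μ ν : ℝ → S → ℝ}

theorem intervalIntegrable (hμ : IsForwardSolution q μ) (x : S) (a b : ℝ) :
    IntervalIntegrable (fun s => μ s x) volume a b :=
  intervalIntegrable_of_norm_le (hμ.measurable x).aestronglyMeasurable (fun s => by
    have hle := mem_Icc_of_mem_stdSimplex (hμ.mem s) x
    exact (Real.norm_of_nonneg hle.1).trans_le hle.2) a b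

theorem intervalIntegrable_mul_rate (hr : IsBoundedRate r) (hμ : IsForwardSolution q μ)
    (x y z : S) (a b : ℝ) : IntervalIntegrable (fun s => μ s x * r s y z) volume a b := by
  obtain ⟨C, hC⟩ := hr.bddAbove
  refine intervalIntegrable_of_norm_le (C := 1 * C)
    ((hμ.measurable x).mul (hr.measurable y z)).aestronglyMeasurable (fun s => ?_) a b
  have hle := mem_Icc_of_mem_stdSimplex (hμ.mem s) x
  rw [Pi.mul_apply, norm_mul, Real.norm_of_nonneg hle.1, Real.norm_of_nonneg (hr.nonneg s y z)]
  exact mul_le_mul hle.2 (hC s y z) (hr.nonneg s y z) zero_le_one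

theorem intervalIntegrable_netFlow (hr : IsBoundedRate r) (hμ : IsForwardSolution q μ) (y : S)
    (a b : ℝ) : IntervalIntegrable (fun s => netFlow (r s) (μ s) y) volume a b := by
  simpa only [netFlow, Finset.sum_fn] using IntervalIntegrable.sum Finset.univ fun x _ =>
    (hμ.intervalIntegrable_mul_rate hr x x y a b).sub
      (hμ.intervalIntegrable_mul_rate hr y y x a b)

theorem intervalIntegrable_netFlow_sub {p : S → S → ℝ} (hr : IsBoundedRate r)
    (hp : IsBoundedRate fun _ => p) (hμ : IsForwardSolution q μ) (y : S) (a b : ℝ) :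
    IntervalIntegrable (fun s => netFlow (r s - p) (μ s) y) volume a b := by
  simpa only [netFlow_sub_left, Pi.sub_apply] using
    (hμ.intervalIntegrable_netFlow hr y a b).sub (hμ.intervalIntegrable_netFlow hp y a b)

theorem eq_add_integral (hq : IsBoundedRate q) (hμ : IsForwardSolution q μ) {a t : ℝ} (ha : 0 ≤ a)
    (ht : 0 ≤ t) (y : S) : μ t y = μ a y + ∫ s in a..t, netFlow (q s) (μ s) y := by
  rw [hμ.eq_integral t ht y, hμ.eq_integral a ha y, add_assoc,
    intervalIntegral.integral_add_adjacent_intervals] <;>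
  exact hμ.intervalIntegrable_netFlow hq y _ _

theorem continuousOn (hq : IsBoundedRate q) (hμ : IsForwardSolution q μ) (y : S) :
    ContinuousOn (fun t => μ t y) (Set.Ici 0) :=
  (continuous_const.add (intervalIntegral.continuous_primitive
    (hμ.intervalIntegrable_netFlow hq y) 0)).continuousOn.congr fun t ht => hμ.eq_integral t ht y

theorem expectation_sub_expectation [DecidableEq S] (hq : IsBoundedRate q)
    (hμ : IsForwardSolution q μ) {a b : ℝ} (ha : 0 ≤ a) (hb : 0 ≤ b) {h h' : ℝ → S → ℂ}
    (hh : ∀ t, HasDerivAt h (h' t) t) (hh' : Continuous h') :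
    expectation (μ b) (h b) - expectation (μ a) (h a) =
      ∫ s in a..b, expectation (μ s) (h' s + (generatorMatrix (q s)).mulVec (h s)) := by
  have hparts := fun y => integral_deriv_mul_add_mul_deriv_complex
    (hμ.intervalIntegrable_netFlow hq y a b)
    (fun t ht => hμ.eq_add_integral hq ha ((le_min ha hb).trans ht.1) y)
    (fun t => hasDerivAt_pi.1 (hh t) y) ((continuous_apply y).comp hh')
  calc expectation (μ b) (h b) - expectation (μ a) (h a)
      = ∑ y, ∫ s in a..b, ((netFlow (q s) (μ s) y : ℂ) * h s y + μ s y * h' s y) := by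
        simp only [expectation, ← Finset.sum_sub_distrib]
        exact Finset.sum_congr rfl fun y _ => (hparts y).2.symm
    _ = ∫ s in a..b, ∑ y, ((netFlow (q s) (μ s) y : ℂ) * h s y + μ s y * h' s y) :=
        (intervalIntegral.integral_finsetSum fun y _ => (hparts y).1).symm
    _ = _ := by
        refine intervalIntegral.integral_congr fun s _ => ?_
        simp only [expectation_add, expectation_generatorMatrix_mulVec]
        rw [Finset.sum_add_distrib, add_comm, expectation, expectation]

theorem sum_abs_sub_le_gronwallBound (hq : IsBoundedRate q) (hr : IsBoundedRate r)
    (hμ : IsForwardSolution q μ) (hν : IsForwardSolution r ν) {C η : ℝ}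
    (hC : ∀ s x y, |q s x y| ≤ C) (hη : ∀ s x y, |q s x y - r s x y| ≤ η) {t : ℝ} (ht : 0 ≤ t) :
    ∑ y, |μ t y - ν t y| ≤ gronwallBound (∑ y, |μ 0 y - ν 0 y|) (2 * Fintype.card S * C)
      (2 * Fintype.card S * η) t := by
  set K := 2 * Fintype.card S * C
  set ε := 2 * Fintype.card S * η
  let u : ℝ → ℝ := fun t => ∑ y, |μ t y - ν t y|
  obtain ⟨x, -⟩ := Finset.nonempty_of_sum_ne_zero ((hμ.mem 0).2.trans_ne one_ne_zero)
  have hK : 0 ≤ K := mul_nonneg (by positivity) ((abs_nonneg _).trans (hC 0 x x))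
  have hu : ContinuousOn u (Set.Icc 0 t) := by
    have hμc : ∀ y, ContinuousOn (fun t => μ t y) (Set.Icc 0 t) := fun y =>
      (hμ.continuousOn hq y).mono Set.Icc_subset_Ici_self
    have hνc : ∀ y, ContinuousOn (fun t => ν t y) (Set.Icc 0 t) := fun y =>
      (hν.continuousOn hr y).mono Set.Icc_subset_Ici_self
    fun_prop
  have hflow : ∀ s, ∑ y, |netFlow (q s) (μ s) y - netFlow (r s) (ν s) y| ≤ K * u s + ε := by
    intro s
    simpa only [sum_abs_of_mem_stdSimplex (hν.mem s), mul_one] using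
      sum_abs_netFlow_sub_netFlow_le (hC s) (hη s) (μ s) (ν s)
  have hint := fun y b => (hμ.intervalIntegrable_netFlow hq y 0 b).sub
    (hν.intervalIntegrable_netFlow hr y 0 b)
  suffices ∀ b ∈ Set.Icc 0 t, u b ≤ u 0 + ∫ s in (0 : ℝ)..b, (K * u s + ε) by
    simpa using le_gronwallBound_of_le_integral hK hu this t ⟨ht, le_rfl⟩
  intro b hb
  calc u b ≤ ∑ y, (|μ 0 y - ν 0 y| +
          ∫ s in (0 : ℝ)..b, |netFlow (q s) (μ s) y - netFlow (r s) (ν s) y|) :=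
        Finset.sum_le_sum fun y _ => by
          rw [hμ.eq_integral b hb.1 y, hν.eq_integral b hb.1 y, add_sub_add_comm,
            ← intervalIntegral.integral_sub (hμ.intervalIntegrable_netFlow hq y 0 b)
              (hν.intervalIntegrable_netFlow hr y 0 b)]
          exact (abs_add_le _ _).trans
            (add_le_add_right (intervalIntegral.abs_integral_le_integral_abs hb.1) _)
    _ = u 0 + ∫ s in (0 : ℝ)..b, ∑ y, |netFlow (q s) (μ s) y - netFlow (r s) (ν s) y| := by
        rw [Finset.sum_add_distrib, intervalIntegral.integral_finsetSum fun y _ => (hint y b).abs]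
    _ ≤ u 0 + ∫ s in (0 : ℝ)..b, (K * u s + ε) := by
        gcongr
        refine intervalIntegral.integral_mono_on hb.1 ?_ ?_ fun s _ => hflow s
        · simpa only [Finset.sum_fn] using
            IntervalIntegrable.sum Finset.univ fun y _ => (hint y b).abs
        · have := hu.mono (Set.Icc_subset_Icc_right hb.2)
          exact ContinuousOn.intervalIntegrable_of_Icc hb.1 (by fun_prop)

theorem eq_of_eq_zero (hq : IsBoundedRate q) (hμ : IsForwardSolution q μ)
    (hν : IsForwardSolution q ν) (h0 : μ 0 = ν 0) {t : ℝ} (ht : 0 ≤ t) : μ t = ν t := by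
  obtain ⟨C, hC⟩ := hq.bddAbove
  have hle := hμ.sum_abs_sub_le_gronwallBound hq hq hν (η := 0)
    (fun s x y => (abs_of_nonneg (hq.nonneg s x y)).trans_le (hC s x y)) (by simp) ht
  simp only [h0, sub_self, abs_zero, Finset.sum_const_zero, mul_zero, gronwallBound_ε0_δ0] at hle
  funext y
  exact sub_eq_zero.1 (abs_nonpos_iff.1
    ((Finset.single_le_sum (fun y _ => abs_nonneg _) (Finset.mem_univ y)).trans hle))

theorem shift (hq : IsBoundedRate q) (hμ : IsForwardSolution q μ) {a : ℝ} (ha : 0 ≤ a)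
    (hper : Function.Periodic q a) : IsForwardSolution q fun t => μ (t + a) where
  mem t := hμ.mem _
  measurable y := (hμ.measurable y).comp (measurable_id.add_const a)
  eq_integral t ht y := by
    have hcomp := intervalIntegral.integral_comp_add_right (a := 0) (b := t)
      (fun s => netFlow (q s) (μ s) y) a
    simp only [hper _, zero_add] at hcomp ⊢
    rw [hcomp, hμ.eq_add_integral hq ha (add_nonneg ht ha)]

theorem vecMul (hq : IsBoundedRate q) {p : ℝ → Matrix S S ℝ}
    (hp : ∀ x, IsForwardSolution q fun t => p t x) {m : S → ℝ} (hm : m ∈ stdSimplex ℝ S) :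
    IsForwardSolution q fun t => Matrix.vecMul m (p t) where
  mem t := vecMul_mem_stdSimplex (fun x => (hp x).mem t) hm
  measurable y := Finset.measurable_fun_sum _ fun x _ => ((hp x).measurable y).const_mul _
  eq_integral t ht y := by
    simp only [netFlow_vecMul]
    rw [intervalIntegral.integral_finsetSum fun x _ =>
      ((hp x).intervalIntegrable_netFlow hq y _ _).const_mul _]
    simp only [intervalIntegral.integral_const_mul, Matrix.vecMul, dotProduct,
      ← Finset.sum_add_distrib, ← mul_add]
    exact Finset.sum_congr rfl fun x _ => by rw [(hp x).eq_integral t ht y]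

theorem add_integral_le_exp_mul (hq : IsBoundedRate q) (hμ : IsForwardSolution q μ) {C : ℝ}
    (hC : ∀ s x y, q s x y ≤ C) {t : ℝ} (ht : 0 ≤ t) (x y : S) :
    μ 0 y + ∫ s in (0 : ℝ)..t, Real.exp (C * Fintype.card S * s) * (μ s x * q s x y) ≤
      Real.exp (C * Fintype.card S * t) * μ t y := by
  set c := C * Fintype.card S
  have hexp : ∀ s, HasDerivAt (fun s => Real.exp (c * s)) (c * Real.exp (c * s)) s := fun s => by
    simpa [mul_comm] using ((hasDerivAt_id s).const_mul c).exp
  have hflow := hμ.intervalIntegrable_netFlow hq y 0 t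
  have hparts := integral_deriv_mul_add_mul_deriv hflow
    (fun s hs => hμ.eq_integral s (by simpa [ht] using hs.1) y) hexp (by fun_prop)
  calc μ 0 y + ∫ s in (0 : ℝ)..t, Real.exp (c * s) * (μ s x * q s x y)
      ≤ μ 0 y + ∫ s in (0 : ℝ)..t,
          (netFlow (q s) (μ s) y * Real.exp (c * s) + μ s y * (c * Real.exp (c * s))) := by
        gcongr
        refine intervalIntegral.integral_mono_on ht ?_ ?_ fun s _ => ?_
        · exact (hμ.intervalIntegrable_mul_rate hq x x y 0 t).continuousOn_mul (by fun_prop)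
        · exact (hflow.mul_continuousOn (by fun_prop)).add
            ((hμ.intervalIntegrable y 0 t).mul_continuousOn (by fun_prop))
        · have := mul_le_mul_of_nonneg_left
            (mul_rate_le_netFlow_add (hq.nonneg s) (hC s) (hμ.mem s).1 x y)
            (Real.exp_pos (c * s)).le
          linarith
    _ = Real.exp (c * t) * μ t y := by
        rw [hparts, mul_zero, Real.exp_zero]
        ring

theorem pos_of_irreducible (hq : IsBoundedRate q) (hμ : IsForwardSolution q μ)
    {r : S → S → ℝ} (hirr : Irreducible r) (hpos : ∀ s x y, 0 < r x y → 0 < q s x y)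
    {t : ℝ} (ht : 0 < t) (y : S) : 0 < μ t y := by
  obtain ⟨C, hC⟩ := hq.bddAbove
  obtain ⟨x, hx⟩ : ∃ x, 0 < μ 0 x := by
    by_contra! h
    linarith [Finset.sum_nonpos fun x (_ : x ∈ Finset.univ) => h x, (hμ.mem 0).2]
  suffices 0 < Real.exp (C * Fintype.card S * t) * μ t y from
    pos_of_mul_pos_right this (Real.exp_pos _).le
  induction hirr x y generalizing t with
  | refl =>
    refine (add_pos_of_pos_of_nonneg hx ?_).trans_le (hμ.add_integral_le_exp_mul hq hC ht.le x x)
    exact intervalIntegral.integral_nonneg ht.le fun s _ =>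
      mul_nonneg (Real.exp_pos _).le (mul_nonneg ((hμ.mem s).1 x) (hq.nonneg s x x))
  | @tail z w _ hzw ih =>
    refine (add_pos_of_nonneg_of_pos ((hμ.mem 0).1 w) ?_).trans_le
      (hμ.add_integral_le_exp_mul hq hC ht.le z w)
    refine intervalIntegral.intervalIntegral_pos_of_pos_on
      ((hμ.intervalIntegrable_mul_rate hq z z w 0 t).continuousOn_mul (by fun_prop))
      (fun s hs => ?_) ht
    have hz : 0 < μ s z := pos_of_mul_pos_right (ih hs.1) (Real.exp_pos _).le
    exact mul_pos (Real.exp_pos _) (mul_pos hz (hpos s z w hzw))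

end IsForwardSolution

end ForwardEquation

section TransitionFamily

variable {S : Type*} [Fintype S] [DecidableEq S]

/-- The transition matrices `p t` from time `0` to time `t ≥ 0` of a jump process with rates `q`,
characterized by the forward equation. -/
structure IsTransitionFamily (q : ℝ → S → S → ℝ) (p : ℝ → Matrix S S ℝ) : Prop where
  isForwardSolution : ∀ x, IsForwardSolution q fun t => p t x
  zero : p 0 = 1

namespace IsTransitionFamily

variable {q : ℝ → S → S → ℝ} {p : ℝ → Matrix S S ℝ} {r : S → S → ℝ} {π : S → ℝ}

theorem mem_stdSimplex (hp : IsTransitionFamily q p) (t : ℝ) (x : S) : p t x ∈ stdSimplex ℝ S :=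
  (hp.isForwardSolution x).mem t

theorem eq_vecMul (hq : IsBoundedRate q) (hp : IsTransitionFamily q p) {μ : ℝ → S → ℝ}
    (hμ : IsForwardSolution q μ) {t : ℝ} (ht : 0 ≤ t) : μ t = Matrix.vecMul (μ 0) (p t) :=
  hμ.eq_of_eq_zero hq (.vecMul hq hp.isForwardSolution (hμ.mem 0))
    (by rw [hp.zero, Matrix.vecMul_one]) ht

theorem add_eq_vecMul (hq : IsBoundedRate q) (hp : IsTransitionFamily q p) {μ : ℝ → S → ℝ}
    (hμ : IsForwardSolution q μ) {a : ℝ} (ha : 0 ≤ a) (hper : Function.Periodic q a) {t : ℝ}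
    (ht : 0 ≤ t) : μ (t + a) = Matrix.vecMul (μ a) (p t) := by
  simpa only [zero_add] using hp.eq_vecMul hq (hμ.shift hq ha hper) ht

theorem pos_of_irreducible (hq : IsBoundedRate q) (hp : IsTransitionFamily q p)
    (hirr : Irreducible r) (hpos : ∀ s x y, 0 < r x y → 0 < q s x y) {t : ℝ} (ht : 0 < t)
    (x y : S) : 0 < p t x y :=
  (hp.isForwardSolution x).pos_of_irreducible hq hirr hpos ht y

theorem vecMul_add_eq_of_isInvariantDistribution (hq : IsBoundedRate q)
    (hp : IsTransitionFamily q p) {a : ℝ} (ha : 0 ≤ a) (hper : Function.Periodic q a)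
    {ν : S → ℝ} (hν : IsInvariantDistribution (p a) ν) {t : ℝ} (ht : 0 ≤ t) :
    Matrix.vecMul ν (p (t + a)) = Matrix.vecMul ν (p t) := by
  rw [hp.add_eq_vecMul hq (.vecMul hq hp.isForwardSolution hν.1) ha hper ht, hν.2]

theorem isInvariantDistribution_of_pos (hr : IsBoundedRate fun _ => r)
    (hp : IsTransitionFamily (fun _ => r) p) (hirr : Irreducible r) {a : ℝ} (ha : 0 < a)
    (hπ : IsInvariantDistribution (p a) π) {t : ℝ} (ht : 0 ≤ t) :
    IsInvariantDistribution (p t) π := by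
  have hmem := vecMul_mem_stdSimplex (hp.mem_stdSimplex t) hπ.1
  refine ⟨hπ.1, IsInvariantDistribution.eq_of_pos (hp.mem_stdSimplex a)
    (hp.pos_of_irreducible hr hirr (fun _ _ _ h => h) ha) ⟨hmem, ?_⟩ hπ⟩
  have hsol := IsForwardSolution.vecMul hr hp.isForwardSolution hπ.1
  rw [← hp.add_eq_vecMul hr hsol ht (fun _ => rfl) ha.le, add_comm,
    hp.vecMul_add_eq_of_isInvariantDistribution hr ha.le (fun _ => rfl) hπ ht]

theorem pos_of_isInvariantDistribution (hr : IsBoundedRate fun _ => r)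
    (hp : IsTransitionFamily (fun _ => r) p) (hirr : Irreducible r) {a : ℝ} (ha : 0 < a)
    (hπ : IsInvariantDistribution (p a) π) (x : S) : 0 < π x := by
  have hsol := IsForwardSolution.vecMul hr hp.isForwardSolution hπ.1
  simpa only [hπ.2] using hsol.pos_of_irreducible hr hirr (fun _ _ _ h => h) ha x

theorem existsUnique_isInvariantDistribution [Nonempty S] (hr : IsBoundedRate fun _ => r)
    (hp : IsTransitionFamily (fun _ => r) p) (hirr : Irreducible r) :
    ∃! π, ∀ t, 0 ≤ t → IsInvariantDistribution (p t) π := by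
  obtain ⟨π, hπ, huniq⟩ := JumpLR.existsUnique_isInvariantDistribution (hp.mem_stdSimplex 1)
    (hp.pos_of_irreducible hr hirr (fun _ _ _ h => h) one_pos)
  exact ⟨π, fun t ht => hp.isInvariantDistribution_of_pos hr hirr one_pos hπ ht,
    fun ν hν => huniq ν (hν 1 zero_le_one)⟩

theorem isForwardSolution_const (hq : IsBoundedRate q) (hp : IsTransitionFamily q p)
    (hπ : ∀ t, 0 ≤ t → IsInvariantDistribution (p t) π) : IsForwardSolution q fun _ => π where
  mem _ := (hπ 0 le_rfl).1
  measurable _ := measurable_const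
  eq_integral t ht y := by
    have hsol := IsForwardSolution.vecMul hq hp.isForwardSolution (hπ 0 le_rfl).1
    have heq := hsol.eq_integral t ht y
    rw [(hπ t ht).2, (hπ 0 le_rfl).2] at heq
    refine heq.trans (congrArg (π y + ·) (intervalIntegral.integral_congr fun s hs => ?_))
    rw [Set.uIcc_of_le ht] at hs
    simp only [(hπ s hs.1).2]

theorem exists_sum_abs_sub_le (hr : IsBoundedRate fun _ => r)
    (hp : IsTransitionFamily (fun _ => r) p) (hirr : Irreducible r)
    (hπ : IsInvariantDistribution (p 1) π) :
    ∃ K c : ℝ, 0 < c ∧ ∀ t, 0 ≤ t → ∀ x, ∑ y, |p t x y - π y| ≤ K * Real.exp (-c * t) := by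
  obtain ⟨ρ, hρ, hcontr⟩ := exists_sum_abs_vecMul_le_of_pos (hp.mem_stdSimplex 1)
    (hp.pos_of_irreducible hr hirr (fun _ _ _ h => h) one_pos)
  have hstep : ∀ t, 0 ≤ t → ∀ x, ∑ y, |p (t + 1) x y - π y| ≤ ρ * ∑ y, |p t x y - π y| := by
    intro t ht x
    have hle := hcontr (p t x - π)
      (by simp [Finset.sum_sub_distrib, hπ.1.2, (hp.mem_stdSimplex t x).2])
    rwa [Matrix.sub_vecMul, hπ.2, ← hp.add_eq_vecMul hr (hp.isForwardSolution x) ht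
      (fun _ => rfl) zero_le_one, add_comm] at hle
  have hle_two : ∀ t x, ∑ y, |p t x y - π y| ≤ 2 := fun t x =>
    calc ∑ y, |p t x y - π y| ≤ ∑ y, (|p t x y| + |π y|) :=
          Finset.sum_le_sum fun y _ => abs_sub _ _
      _ = 2 := by
          rw [Finset.sum_add_distrib, sum_abs_of_mem_stdSimplex (hp.mem_stdSimplex t x),
            sum_abs_of_mem_stdSimplex hπ.1, one_add_one_eq_two]
  obtain ⟨K, c, hc, hdecay⟩ := exists_le_mul_exp_neg (φ := fun t => ∑ x, ∑ y, |p t x y - π y|)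
    (fun t _ => by positivity) (fun t _ => Finset.sum_le_sum fun x _ => hle_two t x) hρ
    (fun t ht => by
      rw [Finset.mul_sum]
      exact Finset.sum_le_sum fun x _ => hstep t ht x)
  exact ⟨K, c, hc, fun t ht x => (Finset.single_le_sum
    (f := fun x => ∑ y, |p t x y - π y|) (fun x _ => by positivity) (Finset.mem_univ x)).trans
    (hdecay t ht)⟩

end IsTransitionFamily

theorem tendsto_gronwallBound {ι : Type*} {l : Filter ι} {δ ε : ι → ℝ} (hδ : Tendsto δ l (𝓝 0))
    (hε : Tendsto ε l (𝓝 0)) (K x : ℝ) :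
    Tendsto (fun i => gronwallBound (δ i) K (ε i) x) l (𝓝 0) := by
  by_cases hK : K = 0
  · simpa [hK, gronwallBound_K0] using hδ.add (hε.mul_const x)
  · simpa [gronwallBound_of_K_ne_0 hK] using
      (hδ.mul_const (Real.exp (K * x))).add ((hε.div_const K).mul_const (Real.exp (K * x) - 1))

section Stability

variable {r : S → S → ℝ} {p : ℝ → Matrix S S ℝ} {π : S → ℝ} {q : ℝ → S → S → ℝ} {μ : ℝ → S → ℝ}

-- If `m` is the initial law, `m - π` is `(m - π) p_T` up to a Grönwall error, and `p_T` contracts.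
theorem IsTransitionFamily.sum_abs_sub_le_of_periodic (hr : IsBoundedRate fun _ => r)
    (hp : IsTransitionFamily (fun _ => r) p) {T : ℝ} (hT : 0 ≤ T)
    (hπ : IsInvariantDistribution (p T) π) {ρ : ℝ} (hρ : ρ < 1)
    (hcontr : ∀ m : S → ℝ, ∑ x, m x = 0 → ∑ y, |Matrix.vecMul m (p T) y| ≤ ρ * ∑ x, |m x|)
    (hq : IsBoundedRate q) (hμ : IsForwardSolution q μ) (hper : μ T = μ 0) {C η : ℝ}
    (hC : ∀ x y, |r x y| ≤ C) (hη : ∀ s x y, |q s x y - r x y| ≤ η) :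
    ∑ y, |μ 0 y - π y| ≤
      gronwallBound 0 (2 * Fintype.card S * C) (2 * Fintype.card S * η) T / (1 - ρ) := by
  have herr := (IsForwardSolution.vecMul hr hp.isForwardSolution
    (hμ.mem 0)).sum_abs_sub_le_gronwallBound hr hq hμ (fun _ => hC)
      (fun s x y => (abs_sub_comm _ _).trans_le (hη s x y)) hT
  simp only [hp.zero, Matrix.vecMul_one, sub_self, abs_zero, Finset.sum_const_zero, hper] at herr
  have hle := hcontr (μ 0 - π) (by simp [Finset.sum_sub_distrib, hπ.1.2, (hμ.mem 0).2])
  rw [Matrix.sub_vecMul, hπ.2] at hle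
  have htri : ∑ y, |μ 0 y - π y| ≤ ∑ y, |Matrix.vecMul (μ 0) (p T) y - μ 0 y| +
      ∑ y, |(Matrix.vecMul (μ 0) (p T) - π) y| := by
    rw [← Finset.sum_add_distrib]
    refine Finset.sum_le_sum fun y _ => ?_
    rw [abs_sub_comm (Matrix.vecMul (μ 0) (p T) y)]
    exact abs_sub_le _ _ _
  rw [le_div_iff₀ (sub_pos.2 hρ)]
  simp only [Pi.sub_apply] at hle htri
  linarith

theorem IsTransitionFamily.tendsto_of_periodic {ι : Type*} {l : Filter ι}
    (hr : IsBoundedRate fun _ => r) (hp : IsTransitionFamily (fun _ => r) p)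
    (hirr : Irreducible r) (hπ : ∀ t, 0 ≤ t → IsInvariantDistribution (p t) π)
    {q : ι → ℝ → S → S → ℝ} {μ : ι → ℝ → S → ℝ} (hq : ∀ i, IsBoundedRate (q i))
    (hμ : ∀ i, IsForwardSolution (q i) (μ i)) {T : ℝ} (hT : 0 < T) (hper : ∀ i, μ i T = μ i 0)
    {η : ι → ℝ} (hη : Tendsto η l (𝓝 0)) (hqη : ∀ᶠ i in l, ∀ s x y, |q i s x y - r x y| ≤ η i)
    {t : ℝ} (ht : 0 ≤ t) (y : S) : Tendsto (fun i => μ i t y) l (𝓝 (π y)) := by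
  obtain ⟨C, hC⟩ := hr.bddAbove
  have hC' : ∀ x y, |r x y| ≤ C := fun x y => (abs_of_nonneg (hr.nonneg 0 x y)).trans_le (hC 0 x y)
  obtain ⟨ρ, hρ, hcontr⟩ := exists_sum_abs_vecMul_le_of_pos (hp.mem_stdSimplex T)
    (hp.pos_of_irreducible hr hirr (fun _ _ _ h => h) hT)
  set K := 2 * Fintype.card S * C
  have hε : Tendsto (fun i => 2 * Fintype.card S * η i) l (𝓝 0) := by
    simpa using hη.const_mul (2 * Fintype.card S : ℝ)
  have hinit : Tendsto (fun i => ∑ y, |π y - μ i 0 y|) l (𝓝 0) := by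
    refine squeeze_zero' (.of_forall fun i => by positivity) (hqη.mono fun i hi => ?_)
      (by simpa using (tendsto_gronwallBound tendsto_const_nhds hε K T).div_const (1 - ρ))
    simp only [abs_sub_comm (π _)]
    exact hp.sum_abs_sub_le_of_periodic hr hT.le (hπ T hT.le) hρ hcontr (hq i) (hμ i) (hper i)
      hC' hi
  have hdist : Tendsto (fun i => |π y - μ i t y|) l (𝓝 0) := by
    refine squeeze_zero' (.of_forall fun i => abs_nonneg _) (hqη.mono fun i hi => ?_)
      (tendsto_gronwallBound hinit hε K t)
    exact (Finset.single_le_sum (f := fun y => |π y - μ i t y|) (fun y _ => abs_nonneg _)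
      (Finset.mem_univ y)).trans ((hp.isForwardSolution_const hr hπ).sum_abs_sub_le_gronwallBound hr
        (hq i) (hμ i) (fun _ => hC') (fun s x y => (abs_sub_comm _ _).trans_le (hi s x y)) ht)
  refine tendsto_iff_dist_tendsto_zero.2 (hdist.congr fun i => ?_)
  rw [Real.dist_eq, abs_sub_comm]

end Stability

end TransitionFamily

section TwistedGenerator

variable {S : Type*} [Fintype S]

/-- The observable `f` minus its mean under `π`. -/
def centered (π : S → ℝ) (f : S → ℂ) : S → ℂ :=
  fun x => f x - expectation π f

theorem expectation_centered {m : S → ℝ} (hm : m ∈ stdSimplex ℝ S) (π : S → ℝ) (f : S → ℂ) :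
    expectation m (centered π f) = expectation m f - expectation π f := by
  simp only [expectation, centered, mul_sub, Finset.sum_sub_distrib]
  rw [← Finset.sum_mul, ← Complex.ofReal_sum, hm.2, Complex.ofReal_one, one_mul]

theorem hasDerivAt_cexp_mul_ofReal (z : ℂ) (t : ℝ) :
    HasDerivAt (fun s : ℝ => Complex.exp (z * s)) (z * Complex.exp (z * t)) t := by
  simpa [mul_comm] using (((hasDerivAt_id (t : ℂ)).const_mul z).cexp).comp_ofReal

theorem norm_cexp_mul_ofReal {z : ℂ} (hz : z.re = 0) (t : ℝ) : ‖Complex.exp (z * t)‖ = 1 := by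
  simp [Complex.norm_exp, hz]

variable [DecidableEq S]

/-- The operator `L + z`, for the generator `L` of the rates `r`, whose semigroup is
`e^{zs} e^{sL}`. -/
def twistedGenerator (r : S → S → ℝ) (z : ℂ) : Matrix S S ℂ :=
  generatorMatrix r + z • (1 : Matrix S S ℂ)

theorem twistedGenerator_mulVec (r : S → S → ℝ) (z : ℂ) (f : S → ℂ) :
    (twistedGenerator r z).mulVec f = (generatorMatrix r).mulVec f + z • f := by
  rw [twistedGenerator, Matrix.add_mulVec, Matrix.smul_mulVec, Matrix.one_mulVec]

/-- The potential `∫₀^∞ e^{s(L + z)} (f - π f) ds` of the centered observable `f`. -/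
noncomputable def potential (r : S → S → ℝ) (π : S → ℝ) (z : ℂ) (f : S → ℂ) : S → ℂ :=
  ∫ s in Set.Ioi (0 : ℝ), (NormedSpace.exp ((s : ℂ) • twistedGenerator r z)).mulVec (centered π f)

namespace IsTransitionFamily

variable {r : S → S → ℝ} {p : ℝ → Matrix S S ℝ} {π : S → ℝ}

-- Backward and forward evolution cancel: `s ↦ E_{p_s(x,·)} (e^{zs} e^{(t-s)(L+z)} f)` is constant.
theorem exp_smul_twistedGenerator_mulVec (hr : IsBoundedRate fun _ => r)
    (hp : IsTransitionFamily (fun _ => r) p) (z : ℂ) (f : S → ℂ) {t : ℝ} (ht : 0 ≤ t) (x : S) :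
    (NormedSpace.exp ((t : ℂ) • twistedGenerator r z)).mulVec f x =
      Complex.exp (z * t) * expectation (p t x) f := by
  set A := twistedGenerator r z with hA
  let u : ℝ → S → ℂ := fun s => (NormedSpace.exp (((t - s : ℝ) : ℂ) • A)).mulVec f
  have hu : ∀ s, HasDerivAt u (-A.mulVec (u s)) s := fun s =>
    ((hasDerivAt_exp_smul_mulVec A f (t - s)).scomp s
      ((hasDerivAt_id s).const_sub t)).congr_deriv (by rw [neg_smul, one_smul])
  have hu_cont : Continuous u := continuous_iff_continuousAt.2 fun s => (hu s).continuousAt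
  have hderiv : ∀ s : ℝ, HasDerivAt (fun s : ℝ => Complex.exp (z * s) • u s)
      (-(generatorMatrix r).mulVec (Complex.exp (z * s) • u s)) s := fun s => by
    refine ((hasDerivAt_cexp_mul_ofReal z s).smul (hu s)).congr_deriv ?_
    rw [hA, twistedGenerator_mulVec, Matrix.mulVec_smul]
    module
  have hdynkin := (hp.isForwardSolution x).expectation_sub_expectation hr le_rfl ht hderiv
    (by fun_prop)
  have hut : u t = f := by simp [u]
  have hu0 : expectation (p 0 x) (u 0) = u 0 x := by
    simp [expectation, hp.zero, Matrix.one_apply, apply_ite Complex.ofReal]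
  have hzero : ∀ s, expectation (p s x) 0 = 0 := fun s => by simp [expectation]
  simp only [neg_add_cancel, expectation_smul, hut, hu0, hzero, intervalIntegral.integral_zero,
    Complex.ofReal_zero, mul_zero, Complex.exp_zero, one_mul, sub_eq_zero] at hdynkin
  simpa [u] using hdynkin.symm

theorem exists_norm_exp_smul_mulVec_centered_le (hr : IsBoundedRate fun _ => r)
    (hp : IsTransitionFamily (fun _ => r) p) (hirr : Irreducible r)
    (hπ : IsInvariantDistribution (p 1) π) {z : ℂ} (hz : z.re = 0) (f : S → ℂ) :
    ∃ K c : ℝ, 0 < c ∧ ∀ s : ℝ, 0 ≤ s →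
      ‖(NormedSpace.exp ((s : ℂ) • twistedGenerator r z)).mulVec (centered π f)‖ ≤
        K * Real.exp (-c * s) := by
  obtain ⟨K, c, hc, hdecay⟩ := hp.exists_sum_abs_sub_le hr hirr hπ
  refine ⟨max K 0 * ‖f‖, c, hc, fun s hs => ?_⟩
  refine (pi_norm_le_iff_of_nonneg (by positivity)).2 fun x => ?_
  calc ‖(NormedSpace.exp ((s : ℂ) • twistedGenerator r z)).mulVec (centered π f) x‖
      = ‖expectation (p s x - π) f‖ := by
        rw [hp.exp_smul_twistedGenerator_mulVec hr z _ hs, norm_mul, norm_cexp_mul_ofReal hz,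
          one_mul, expectation_centered (hp.mem_stdSimplex s x), expectation_sub_left]
    _ ≤ (∑ y, |(p s x - π) y|) * ‖f‖ := norm_expectation_le _ _
    _ ≤ max K 0 * Real.exp (-c * s) * ‖f‖ := by
        gcongr
        exact (hdecay s hs x).trans (by gcongr; exact le_max_left K 0)
    _ = max K 0 * ‖f‖ * Real.exp (-c * s) := by ring

theorem integrableOn_exp_smul_mulVec_centered (hr : IsBoundedRate fun _ => r)
    (hp : IsTransitionFamily (fun _ => r) p) (hirr : Irreducible r)
    (hπ : IsInvariantDistribution (p 1) π) {z : ℂ} (hz : z.re = 0) (f : S → ℂ) :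
    IntegrableOn (fun s : ℝ => (NormedSpace.exp ((s : ℂ) • twistedGenerator r z)).mulVec
      (centered π f)) (Set.Ioi 0) := by
  obtain ⟨K, c, hc, hdecay⟩ := hp.exists_norm_exp_smul_mulVec_centered_le hr hirr hπ hz f
  exact integrableOn_exp_smul_mulVec hc hdecay

theorem twistedGenerator_mulVec_potential (hr : IsBoundedRate fun _ => r)
    (hp : IsTransitionFamily (fun _ => r) p) (hirr : Irreducible r)
    (hπ : IsInvariantDistribution (p 1) π) {z : ℂ} (hz : z.re = 0) (f : S → ℂ) :
    (twistedGenerator r z).mulVec (potential r π z f) = -centered π f := by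
  obtain ⟨K, c, hc, hdecay⟩ := hp.exists_norm_exp_smul_mulVec_centered_le hr hirr hπ hz f
  exact mulVec_integral_exp_smul_mulVec hc hdecay

end IsTransitionFamily

end TwistedGenerator

section LinearResponse

variable {S : Type*} [Fintype S] [DecidableEq S] {r : S → S → ℝ}

-- Integrate `d/dt E_{μ_t} (e^{zt} w)` over a period.
theorem IsForwardSolution.integral_cexp_mul_expectation {q : ℝ → S → S → ℝ} {μ : ℝ → S → ℝ}
    (hr : IsBoundedRate fun _ => r) (hq : IsBoundedRate q) (hμ : IsForwardSolution q μ)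
    {T : ℝ} (hT : 0 ≤ T) (hper : μ T = μ 0) {z : ℂ} (hzT : Complex.exp (z * T) = 1)
    (w : S → ℂ) :
    ∫ t in (0 : ℝ)..T, Complex.exp (z * t) * expectation (μ t) (-(twistedGenerator r z).mulVec w) =
      ∫ t in (0 : ℝ)..T, Complex.exp (z * t) * expectation (netFlow (q t - r) (μ t)) w := by
  have hdynkin := hμ.expectation_sub_expectation hq le_rfl hT
    (fun t => (hasDerivAt_cexp_mul_ofReal z t).smul_const w) (by fun_prop)
  rw [hper, Complex.ofReal_zero, mul_zero, Complex.exp_zero, hzT, sub_self] at hdynkin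
  have hint : ∀ (n : ℝ → S → ℝ) (f : S → ℂ), (∀ x, IntervalIntegrable (fun t => n t x) volume 0 T) →
      IntervalIntegrable (fun t => Complex.exp (z * t) * expectation (n t) f) volume 0 T :=
    fun n f hn => (intervalIntegrable_expectation hn f).continuousOn_mul (by fun_prop)
  rw [← sub_eq_zero, ← intervalIntegral.integral_sub, ← neg_eq_zero,
    ← intervalIntegral.integral_neg, hdynkin]
  · refine intervalIntegral.integral_congr fun t _ => ?_
    have hneg : ∀ f, expectation (μ t) (-f) = -expectation (μ t) f := fun f => by simp [expectation]
    simp only [hneg, twistedGenerator_mulVec, Matrix.mulVec_smul, netFlow_sub_left,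
      expectation_sub_left, expectation_add, expectation_smul, expectation_generatorMatrix_mulVec]
    ring
  · exact hint μ _ fun x => hμ.intervalIntegrable x 0 T
  · exact hint _ w fun x => hμ.intervalIntegrable_netFlow_sub hq hr x 0 T

variable {p : ℝ → Matrix S S ℝ} {π : S → ℝ}

theorem IsTransitionFamily.integral_cexp_mul_expectation (hr : IsBoundedRate fun _ => r)
    (hp : IsTransitionFamily (fun _ => r) p) (hirr : Irreducible r)
    (hπ : IsInvariantDistribution (p 1) π) {q : ℝ → S → S → ℝ} {μ : ℝ → S → ℝ}
    (hq : IsBoundedRate q) (hμ : IsForwardSolution q μ) {T : ℝ} (hT : 0 ≤ T) (hper : μ T = μ 0)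
    {z : ℂ} (hz : z.re = 0) (hzT : Complex.exp (z * T) = 1) (f : S → ℂ) :
    ∫ t in (0 : ℝ)..T, Complex.exp (z * t) * expectation (μ t) f =
      (∫ t in (0 : ℝ)..T, Complex.exp (z * t) * expectation (netFlow (q t - r) (μ t))
        (potential r π z f)) + ∫ t in (0 : ℝ)..T, Complex.exp (z * t) * expectation π f := by
  rw [← hμ.integral_cexp_mul_expectation hr hq hT hper hzT,
    hp.twistedGenerator_mulVec_potential hr hirr hπ hz, neg_neg, ← sub_eq_iff_eq_add,
    ← intervalIntegral.integral_sub]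
  · simp only [expectation_centered (hμ.mem _), mul_sub]
  · exact (intervalIntegrable_expectation (fun x => hμ.intervalIntegrable x 0 T) f).continuousOn_mul
      (by fun_prop)
  · exact Continuous.intervalIntegrable (by fun_prop) _ _

theorem IsTransitionFamily.hasDerivAt_integral_cexp_mul_expectation (hr : IsBoundedRate fun _ => r)
    (hp : IsTransitionFamily (fun _ => r) p) (hirr : Irreducible r)
    (hπ : ∀ t, 0 ≤ t → IsInvariantDistribution (p t) π)
    {q : ℝ → ℝ → S → S → ℝ} {q' : ℝ → S → S → ℝ} {μ : ℝ → ℝ → S → ℝ} {B : ℝ}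
    (hq : ∀ lam, IsBoundedRate (q lam)) (hμ : ∀ lam, IsForwardSolution (q lam) (μ lam))
    (hqB : ∀ᶠ lam in 𝓝 (0 : ℝ), ∀ s x y, |q lam s x y - r x y| ≤ B * |lam|)
    (hq' : ∀ s x y, HasDerivAt (fun lam => q lam s x y) (q' s x y) 0)
    {T : ℝ} (hT : 0 < T) (hper : ∀ lam, μ lam T = μ lam 0)
    {z : ℂ} (hz : z.re = 0) (hzT : Complex.exp (z * T) = 1) (f : S → ℂ) :
    HasDerivAt (fun lam => ∫ t in (0 : ℝ)..T, Complex.exp (z * t) * expectation (μ lam t) f)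
      (∫ t in (0 : ℝ)..T, Complex.exp (z * t) *
        expectation (netFlow (q' t) π) (potential r π z f)) 0 := by
  set w := potential r π z f
  have hq0 : ∀ s, q 0 s = r := fun s => by
    funext x y
    simpa [sub_eq_zero] using hqB.self_of_nhds s x y
  have hη : Tendsto (fun lam : ℝ => B * |lam|) (𝓝 0) (𝓝 0) := by
    simpa using (continuous_abs.tendsto (0 : ℝ)).const_mul B
  have hint : ∀ lam, IntervalIntegrable (fun t => Complex.exp (z * t) *
      expectation (netFlow (q lam t - r) (μ lam t)) w) volume 0 T := fun lam =>
    (intervalIntegrable_expectation (fun x =>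
      (hμ lam).intervalIntegrable_netFlow_sub (hq lam) hr x 0 T) w).continuousOn_mul (by fun_prop)
  simp only [hp.integral_cexp_mul_expectation hr hirr (hπ 1 zero_le_one) (hq _) (hμ _) hT.le
    (hper _) hz hzT f]
  refine (hasDerivAt_intervalIntegral_of_norm_sub_le (B := 2 * Fintype.card S * B * ‖w‖) hint ?_
    fun t ht => ?_).add_const _
  · filter_upwards [hqB] with lam hlam t _
    have hzero : expectation (netFlow (q 0 t - r) (μ 0 t)) w = 0 := by
      simp [hq0, netFlow, expectation]
    rw [hzero, mul_zero, sub_zero, norm_mul, norm_cexp_mul_ofReal hz, one_mul, sub_zero]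
    calc ‖expectation (netFlow (q lam t - r) (μ lam t)) w‖
        ≤ 2 * Fintype.card S * (B * |lam|) * 1 * ‖w‖ := by
          rw [← sum_abs_of_mem_stdSimplex ((hμ lam).mem t)]
          refine (norm_expectation_le _ _).trans ?_
          gcongr
          exact sum_abs_netFlow_le (hlam t) _
      _ = 2 * Fintype.card S * B * ‖w‖ * |lam| := by ring
  · have ht0 : 0 ≤ t := (Set.uIoc_of_le hT.le ▸ ht).1.le
    have hflow := fun y => hasDerivAt_netFlow_sub (hq' t)
      (hp.tendsto_of_periodic hr hirr hπ hq hμ hT hper hη hqB ht0) y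
    simp only [hq0] at hflow
    exact (HasDerivAt.fun_sum fun y _ => (hflow y).ofReal_comp.mul_const (w y)).const_mul _

end LinearResponse

section PerturbedRate

variable {S : Type*} {r : S → S → ℝ} {g : ℝ → S → S → ℝ}

theorem hasDerivAt_perturbedRate (r : S → S → ℝ) (g : ℝ → S → S → ℝ) (s : ℝ) (x y : S) :
    HasDerivAt (fun lam => perturbedRate r g lam s x y) ((r * g s) x y) 0 := by
  simpa [perturbedRate, mul_comm] using
    (((hasDerivAt_id (0 : ℝ)).mul_const (g s x y)).exp).mul_const (r x y)

theorem perturbedRate_periodic {T : ℝ} (hg : ∀ x y, Function.Periodic (fun s => g s x y) T)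
    (lam : ℝ) : Function.Periodic (perturbedRate r g lam) T := fun s => by
  funext x y
  simp only [perturbedRate, hg x y s]

theorem perturbedRate_pos {x y : S} (h : 0 < r x y) (lam s : ℝ) :
    0 < perturbedRate r g lam s x y :=
  mul_pos (Real.exp_pos _) h

variable [Finite S]

theorem isBoundedRate_perturbedRate (hr : ∀ x y, 0 ≤ r x y)
    (hg_meas : ∀ x y, Measurable fun s => g s x y) (hg_bdd : ∃ M, ∀ s x y, |g s x y| ≤ M)
    (lam : ℝ) : IsBoundedRate (perturbedRate r g lam) where
  measurable x y := (((hg_meas x y).const_mul lam).exp).mul_const _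
  nonneg s x y := mul_nonneg (Real.exp_pos _).le (hr x y)
  bddAbove := by
    obtain ⟨M, hM⟩ := hg_bdd
    obtain ⟨R, hR⟩ := Finite.exists_le fun z : S × S => r z.1 z.2
    refine ⟨Real.exp (|lam| * M) * R, fun s x y => ?_⟩
    refine mul_le_mul (Real.exp_le_exp.2 ?_) (hR (x, y)) (hr x y) (Real.exp_pos _).le
    exact (le_abs_self _).trans ((abs_mul _ _).trans_le (by gcongr; exact hM s x y))

theorem exists_abs_perturbedRate_sub_le (r : S → S → ℝ)
    (hg_bdd : ∃ M, ∀ s x y, |g s x y| ≤ M) :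
    ∃ B, ∀ᶠ lam in 𝓝 (0 : ℝ), ∀ s x y, |perturbedRate r g lam s x y - r x y| ≤ B * |lam| := by
  obtain ⟨M, hM⟩ := hg_bdd
  obtain ⟨R, hR⟩ := Finite.exists_le fun z : S × S => |r z.1 z.2|
  have hsmall : ∀ᶠ lam in 𝓝 (0 : ℝ), |lam| * M ≤ 1 := by
    refine Tendsto.eventually_le_const one_pos ?_
    simpa using (continuous_abs.tendsto (0 : ℝ)).mul_const M
  refine ⟨2 * M * R, hsmall.mono fun lam hlam s x y => ?_⟩
  have hexponent : |lam * g s x y| ≤ |lam| * M :=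
    (abs_mul _ _).trans_le (by gcongr; exact hM s x y)
  calc |perturbedRate r g lam s x y - r x y| = |Real.exp (lam * g s x y) - 1| * |r x y| := by
        rw [← abs_mul, perturbedRate, sub_one_mul]
    _ ≤ 2 * |lam * g s x y| * |r x y| := by
        gcongr
        exact Real.abs_exp_sub_one_le (hexponent.trans hlam)
    _ ≤ 2 * (|lam| * M) * R :=
        mul_le_mul (mul_le_mul_of_nonneg_left hexponent zero_le_two) (hR (x, y)) (abs_nonneg _)
          (mul_nonneg zero_le_two ((abs_nonneg _).trans hexponent))
    _ = 2 * M * R * |lam| := by ring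

end PerturbedRate

section PsiHat

variable {S : Type*} [Fintype S] {r : S → S → ℝ} {g : ℝ → S → S → ℝ} {π : S → ℝ} {T : ℝ} {k : ℤ}

/-- The exponent `-ikω`, `ω = 2π / T`, of the `k`-th Fourier mode. -/
noncomputable def fourierExponent (T : ℝ) (k : ℤ) : ℂ :=
  -Complex.I * k * ((2 * Real.pi / T : ℝ) : ℂ)

theorem fourierExponent_re (T : ℝ) (k : ℤ) : (fourierExponent T k).re = 0 := by
  simp [fourierExponent]

theorem exp_fourierExponent_mul (hT : T ≠ 0) (k : ℤ) :
    Complex.exp (fourierExponent T k * T) = 1 := by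
  have hT' : (T : ℂ) ≠ 0 := Complex.ofReal_ne_zero.2 hT
  refine Complex.exp_eq_one_iff.2 ⟨-k, ?_⟩
  rw [fourierExponent]
  push_cast
  field_simp

theorem mul_psi_eq_netFlow (hπ : ∀ x, π x ≠ 0) (t : ℝ) (x : S) :
    π x * psi r g π t x = netFlow (r * g t) π x := by
  have := hπ x
  simp only [psi, netFlow, reversedRate, Finset.mul_sum, Pi.mul_apply]
  refine Finset.sum_congr rfl fun y _ => ?_
  field_simp

theorem intervalIntegrable_psi (hg_meas : ∀ x y, Measurable fun s => g s x y)
    (hg_bdd : ∃ M, ∀ s x y, |g s x y| ≤ M) (x : S) (a b : ℝ) :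
    IntervalIntegrable (fun t => psi r g π t x) volume a b := by
  obtain ⟨M, hM⟩ := hg_bdd
  have hg : ∀ x y, IntervalIntegrable (fun t => g t x y) volume a b := fun x y =>
    intervalIntegrable_of_norm_le (hg_meas x y).aestronglyMeasurable (fun t => hM t x y) a b
  simpa only [psi, Finset.sum_fn] using IntervalIntegrable.sum Finset.univ fun y _ =>
    ((hg y x).const_mul (reversedRate r π x y)).sub ((hg x y).const_mul (r x y))

/-- The bilinear pairing `f ↦ ∑ₓ π(x) ψ̂ₖ(x) f(x)` with `ψ̂ₖ` in `L²(π)`. -/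
noncomputable def psiHatPairing (r : S → S → ℝ) (g : ℝ → S → S → ℝ) (π : S → ℝ) (T : ℝ) (k : ℤ) :
    (S → ℂ) →L[ℂ] ℂ :=
  ∑ x, ((π x : ℂ) * psiHat r g π T k x) • ContinuousLinearMap.proj x

theorem psiHatPairing_apply (f : S → ℂ) :
    psiHatPairing r g π T k f = ∑ x, (π x : ℂ) * psiHat r g π T k x * f x := by
  simp [psiHatPairing]

theorem psiHatPairing_eq_integral (hπ : ∀ x, π x ≠ 0)
    (hg_meas : ∀ x y, Measurable fun s => g s x y) (hg_bdd : ∃ M, ∀ s x y, |g s x y| ≤ M)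
    (f : S → ℂ) :
    psiHatPairing r g π T k f = (1 / (T : ℂ)) * ∫ t in (0 : ℝ)..T,
      Complex.exp (fourierExponent T k * t) * expectation (netFlow (r * g t) π) f := by
  have hint : ∀ x, IntervalIntegrable (fun t => Complex.exp (fourierExponent T k * t) *
      (psi r g π t x : ℂ)) volume 0 T := fun x => by
    have h := intervalIntegrable_psi (r := r) (π := π) hg_meas hg_bdd x 0 T
    exact IntervalIntegrable.continuousOn_mul ⟨h.1.ofReal, h.2.ofReal⟩ (by fun_prop)
  calc psiHatPairing r g π T k f
      = (1 / (T : ℂ)) * ∑ x, ∫ t in (0 : ℝ)..T,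
          π x * f x * (Complex.exp (fourierExponent T k * t) * (psi r g π t x : ℂ)) := by
        simp only [psiHatPairing_apply, psiHat, fourierCoefficient, fourierExponent,
          intervalIntegral.integral_const_mul, Finset.mul_sum]
        exact Finset.sum_congr rfl fun x _ => by ring
    _ = (1 / (T : ℂ)) * ∫ t in (0 : ℝ)..T, ∑ x,
          π x * f x * (Complex.exp (fourierExponent T k * t) * (psi r g π t x : ℂ)) := by
        rw [intervalIntegral.integral_finsetSum fun x _ => (hint x).const_mul _]
    _ = _ := by
        simp only [expectation, ← mul_psi_eq_netFlow hπ, Complex.ofReal_mul, Finset.mul_sum]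
        congr! 4
        ring

theorem psiHatPairing_const (hπ : ∀ x, π x ≠ 0)
    (hg_meas : ∀ x y, Measurable fun s => g s x y) (hg_bdd : ∃ M, ∀ s x y, |g s x y| ≤ M)
    (c : ℂ) : psiHatPairing r g π T k (fun _ => c) = 0 := by
  classical
  rw [psiHatPairing_eq_integral hπ hg_meas hg_bdd]
  have hzero : ∀ t, expectation (netFlow (r * g t) π) (fun _ => c) = 0 := fun t => by
    rw [← expectation_generatorMatrix_mulVec]
    simp [expectation, generatorMatrix_mulVec]
  simp [hzero]

variable [DecidableEq S] {p : ℝ → Matrix S S ℝ}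

-- The two arguments differ by a constant function of `x`, on which the pairing vanishes.
theorem psiHatPairing_exp_smul_mulVec_centered (hr : IsBoundedRate fun _ => r)
    (hp : IsTransitionFamily (fun _ => r) p) (hπ : ∀ x, π x ≠ 0)
    (hg_meas : ∀ x y, Measurable fun s => g s x y) (hg_bdd : ∃ M, ∀ s x y, |g s x y| ≤ M)
    (z : ℂ) (f : S → ℂ) {s : ℝ} (hs : 0 ≤ s) :
    psiHatPairing r g π T k
        ((NormedSpace.exp ((s : ℂ) • twistedGenerator r z)).mulVec (centered π f)) =
      psiHatPairing r g π T k ((NormedSpace.exp ((s : ℂ) • twistedGenerator r z)).mulVec f) := by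
  rw [← sub_eq_zero, ← map_sub,
    ← psiHatPairing_const hπ hg_meas hg_bdd (-(Complex.exp (z * s) * expectation π f))]
  congr 1
  funext x
  simp only [Pi.sub_apply, hp.exp_smul_twistedGenerator_mulVec hr z _ hs,
    expectation_centered (hp.mem_stdSimplex s x)]
  ring

theorem semigroupPairing_eq_psiHatPairing (hr : IsBoundedRate fun _ => r)
    (hp : IsTransitionFamily (fun _ => r) p) (v : S → ℝ) {s : ℝ} (hs : 0 ≤ s) :
    semigroupPairing r g π T k v s = psiHatPairing r g π T k
      ((NormedSpace.exp ((s : ℂ) • twistedGenerator r (fourierExponent T k))).mulVec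
        fun x => (v x : ℂ)) := by
  have hconj : ∀ x, (starRingEnd ℂ) (Complex.exp
      (Complex.I * k * ((2 * Real.pi / T : ℝ) : ℂ) * s) * expectation (p s x) fun x => (v x : ℂ)) =
      Complex.exp (fourierExponent T k * s) * expectation (p s x) fun x => (v x : ℂ) := fun x => by
    simp only [map_mul, ← Complex.exp_conj, Complex.conj_I, Complex.conj_ofReal, map_intCast,
      expectation, map_sum, fourierExponent]
  rw [semigroupPairing, innerPi, psiHatPairing_apply, ← twistedGenerator]
  simp only [hp.exp_smul_twistedGenerator_mulVec hr _ _ hs, hconj]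
  exact Finset.sum_congr rfl fun x _ => by ring

end PsiHat

section JointMeasurability

variable {Ω : Type*} [MeasurableSpace Ω]

/-- The smallest multiple of `1 / (n + 1)` that is larger than `t`. -/
noncomputable def nextGridPoint (n : ℕ) (t : ℝ≥0) : ℝ≥0 :=
  (⌊(n + 1) * t⌋₊ + 1) / (n + 1)

theorem lt_nextGridPoint (n : ℕ) (t : ℝ≥0) : t < nextGridPoint n t := by
  rw [nextGridPoint, lt_div_iff₀ (by positivity), mul_comm]
  exact Nat.lt_floor_add_one _

theorem nextGridPoint_le (n : ℕ) (t : ℝ≥0) : nextGridPoint n t ≤ t + 1 / (n + 1) := by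
  rw [nextGridPoint, add_div, mul_comm]
  gcongr
  exact div_le_of_le_mul₀ (by positivity) (by positivity) (Nat.floor_le (by positivity))

theorem tendsto_nextGridPoint (t : ℝ≥0) :
    Tendsto (fun n => nextGridPoint n t) atTop (𝓝[≥] t) := by
  refine tendsto_nhdsWithin_iff.2 ⟨?_, .of_forall fun n => (lt_nextGridPoint n t).le⟩
  refine tendsto_of_tendsto_of_tendsto_of_le_of_le tendsto_const_nhds ?_
    (fun n => (lt_nextGridPoint n t).le) fun n => nextGridPoint_le n t
  simpa using tendsto_const_nhds.add (tendsto_one_div_add_atTop_nhds_zero_nat (𝕜 := ℝ≥0))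

theorem measurable_uncurry_of_continuousWithinAt_Ici {E : Type*} [TopologicalSpace E]
    [TopologicalSpace.PseudoMetrizableSpace E] [MeasurableSpace E] [BorelSpace E]
    {X : ℝ≥0 → Ω → E} (hX : ∀ t, Measurable (X t))
    (hrc : ∀ ω t, ContinuousWithinAt (fun s => X s ω) (Set.Ici t) t) :
    Measurable (Function.uncurry X) := by
  refine measurable_of_tendsto_metrizable
    (f := fun n (z : ℝ≥0 × Ω) => X (nextGridPoint n z.1) z.2) (fun n => ?_)
    (tendsto_pi_nhds.2 fun z => (hrc z.2 z.1).tendsto.comp (tendsto_nextGridPoint z.1))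
  have hgrid : Measurable fun z : ℕ × Ω => X ((z.1 + 1) / (n + 1)) z.2 :=
    measurable_from_prod_countable_right fun m => hX ((m + 1) / (n + 1))
  have hfloor : Measurable fun z : ℝ≥0 × Ω => (⌊((n : ℝ≥0) + 1) * z.1⌋₊, z.2) :=
    (measurable_fst.const_mul _).nat_floor.prodMk measurable_snd
  simpa only [nextGridPoint, Function.comp_def] using hgrid.comp hfloor

end JointMeasurability

section FiniteValued

variable {Ω : Type*} [MeasurableSpace Ω] {E : Type*} [NormedAddCommGroup E]

theorem integrable_comp_of_finite {S : Type*} [Finite S] [MeasurableSpace S]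
    [DiscreteMeasurableSpace S] (P : Measure Ω) [IsFiniteMeasure P] {Y : Ω → S}
    (hY : Measurable Y) (h : S → E) : Integrable (fun ω => h (Y ω)) P :=
  (Integrable.of_finite (μ := P.map Y) (f := h)).comp_measurable hY

theorem integral_comp_eq_sum {S : Type*} [Fintype S] [MeasurableSpace S]
    [DiscreteMeasurableSpace S] [NormedSpace ℝ E] [CompleteSpace E] (P : Measure Ω)
    [IsFiniteMeasure P] {Y : Ω → S} (hY : Measurable Y) (h : S → E) :
    ∫ ω, h (Y ω) ∂P = ∑ y, P.real {ω | Y ω = y} • h y := by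
  rw [← integral_map hY.aemeasurable
    (Integrable.of_finite (μ := P.map Y) (f := h)).aestronglyMeasurable,
    integral_fintype .of_finite]
  refine Finset.sum_congr rfl fun y _ => ?_
  rw [map_measureReal_apply hY (measurableSet_singleton y)]
  rfl

end FiniteValued

section JumpGenerator

variable {S : Type*} [Fintype S]

theorem sum_mul_jumpGenerator_single [DecidableEq S] (q : S → S → ℝ) (m : S → ℝ) (y : S) :
    ∑ x, m x * jumpGenerator q (Pi.single y 1) x = netFlow q m y := by
  simp [jumpGenerator, netFlow, mul_sub, Finset.sum_sub_distrib, Pi.single_apply, Finset.mul_sum]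

theorem IsBoundedRate.exists_abs_jumpGenerator_le {q : ℝ → S → S → ℝ} (hq : IsBoundedRate q)
    (f : S → ℝ) : ∃ C, ∀ s x, |jumpGenerator (q s) f x| ≤ C := by
  obtain ⟨C, hC⟩ := hq.bddAbove
  refine ⟨∑ x, ∑ y, |C| * |f y - f x|, fun s x => ?_⟩
  calc |jumpGenerator (q s) f x| ≤ ∑ y, |q s x y * (f y - f x)| := Finset.abs_sum_le_sum_abs _ _
    _ ≤ ∑ y, |C| * |f y - f x| := Finset.sum_le_sum fun y _ => by
        rw [abs_mul, abs_of_nonneg (hq.nonneg s x y)]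
        gcongr
        exact (hC s x y).trans (le_abs_self C)
    _ ≤ ∑ x, ∑ y, |C| * |f y - f x| := Finset.single_le_sum
        (f := fun x => ∑ y, |C| * |f y - f x|) (fun x _ => by positivity) (Finset.mem_univ x)

end JumpGenerator

section MarkovJumpProcess

namespace IsMarkovJumpProcess

variable {S : Type*} [Fintype S] [MeasurableSpace S] {Ω : Type*} [MeasurableSpace Ω]
  {q : ℝ → S → S → ℝ} {x₀ : S} {P : Measure Ω} {X : ℝ≥0 → Ω → S}

theorem measureReal_zero [DecidableEq S] (hX : IsMarkovJumpProcess q x₀ P X) (y : S) :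
    P.real {ω | X 0 ω = y} = (1 : Matrix S S ℝ) x₀ y := by
  have := hX.isProbabilityMeasure
  have hstart : {ω | X 0 ω = y} =ᵐ[P] {_ω | x₀ = y} :=
    hX.start.mono fun ω hω => congrArg (· = y) hω
  rw [measureReal_congr hstart, Matrix.one_apply]
  by_cases hxy : x₀ = y <;> simp [hxy]

variable [DiscreteMeasurableSpace S]

theorem measurable_uncurry (hX : IsMarkovJumpProcess q x₀ P X) :
    Measurable fun z : ℝ × Ω => X z.1.toNNReal z.2 := by
  let _ : TopologicalSpace S := ⊥
  have : DiscreteTopology S := ⟨rfl⟩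
  have hunc : Measurable (Function.uncurry X) :=
    measurable_uncurry_of_continuousWithinAt_Ici hX.measurable fun ω t =>
      tendsto_const_nhds.congr' ((hX.rightContinuous ω t).mono fun s hs => hs.symm)
  exact hunc.comp (measurable_real_toNNReal.prodMap measurable_id)

theorem measurable_measureReal (hX : IsMarkovJumpProcess q x₀ P X) (y : S) :
    Measurable fun t : ℝ => P.real {ω | X t.toNNReal ω = y} := by
  have := hX.isProbabilityMeasure
  exact (measurable_measure_prodMk_left (ν := P)
    (hX.measurable_uncurry (measurableSet_singleton y))).ennreal_toReal

theorem measureReal_mem_stdSimplex (hX : IsMarkovJumpProcess q x₀ P X) (t : ℝ≥0) :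
    (fun y => P.real {ω | X t ω = y}) ∈ stdSimplex ℝ S := by
  have := hX.isProbabilityMeasure
  refine ⟨fun y => measureReal_nonneg, ?_⟩
  simpa using (integral_comp_eq_sum P (hX.measurable t) fun _ => (1 : ℝ)).symm

theorem integrable_jumpGenerator (hq : IsBoundedRate q) (hX : IsMarkovJumpProcess q x₀ P X)
    (f : S → ℝ) (t : ℝ) :
    Integrable (fun z : ℝ × Ω => jumpGenerator (q z.1) f (X z.1.toNNReal z.2))
      ((volume.restrict (Set.uIoc 0 t)).prod P) := by
  have := hX.isProbabilityMeasure
  have : IsFiniteMeasure (volume.restrict (Set.uIoc 0 t)) :=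
    Real.isFiniteMeasure_restrict_Ioc _ _
  obtain ⟨C, hC⟩ := hq.exists_abs_jumpGenerator_le f
  have hgen : Measurable fun z : ℝ × S => jumpGenerator (q z.1) f z.2 :=
    measurable_from_prod_countable_left fun x =>
      Finset.measurable_fun_sum _ fun y _ => (hq.measurable x y).mul_const (f y - f x)
  exact .of_bound (hgen.comp (measurable_fst.prodMk hX.measurable_uncurry)).aestronglyMeasurable C
    (.of_forall fun z => hC z.1 _)

theorem integral_comp_sub_integral_comp (hq : IsBoundedRate q)
    (hX : IsMarkovJumpProcess q x₀ P X) (f : S → ℝ) {t : ℝ} (ht : 0 ≤ t) :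
    ∫ ω, f (X t.toNNReal ω) ∂P - ∫ ω, f (X 0 ω) ∂P =
      ∫ s in (0 : ℝ)..t, ∫ ω, jumpGenerator (q s) f (X s.toNNReal ω) ∂P := by
  have := hX.isProbabilityMeasure
  obtain ⟨ℱ, -, hmart⟩ := hX.martingaleProblem
  have hcomp : ∀ s, Integrable (fun ω => f (X s ω)) P := fun s =>
    integrable_comp_of_finite P (hX.measurable s) f
  have hgen := hX.integrable_jumpGenerator hq f t
  have hint : Integrable
      (fun ω => ∫ s in (0 : ℝ)..t, jumpGenerator (q s) f (X s.toNNReal ω)) P := by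
    simp only [intervalIntegral.integral_of_le ht]
    rw [Set.uIoc_of_le ht] at hgen
    exact hgen.integral_prod_right
  have hdiff : Integrable (fun ω => f (X t.toNNReal ω) - f (X 0 ω)) P := (hcomp _).sub (hcomp 0)
  have hmean := (hmart f).setIntegral_eq (zero_le (a := t.toNNReal)) MeasurableSet.univ
  simp only [setIntegral_univ, NNReal.coe_zero, intervalIntegral.integral_same, sub_self,
    integral_zero, Real.coe_toNNReal t ht] at hmean
  rw [intervalIntegral_integral_swap hgen, ← integral_sub (hcomp _) (hcomp 0), ← sub_eq_zero,
    ← integral_sub hdiff hint]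
  exact hmean.symm

theorem isForwardSolution (hq : IsBoundedRate q) (hX : IsMarkovJumpProcess q x₀ P X) :
    IsForwardSolution q fun t y => P.real {ω | X t.toNNReal ω = y} where
  mem t := hX.measureReal_mem_stdSimplex _
  measurable y := hX.measurable_measureReal y
  eq_integral t ht y := by
    classical
    have := hX.isProbabilityMeasure
    have hdynkin := hX.integral_comp_sub_integral_comp hq (Pi.single y 1) ht
    simp only [integral_comp_eq_sum P (hX.measurable _), smul_eq_mul,
      sum_mul_jumpGenerator_single] at hdynkin
    simp only [Pi.single_apply, mul_ite, mul_one, mul_zero, Finset.sum_ite_eq', Finset.mem_univ,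
      if_true] at hdynkin
    simpa only [Real.toNNReal_zero] using eq_add_of_sub_eq' hdynkin

end IsMarkovJumpProcess

end MarkovJumpProcess

section MarkovFamily

variable {S : Type*} [Fintype S] {Ω : Type*} [MeasurableSpace Ω] {P : S → Measure Ω}

theorem integral_lawFrom {m : S → ℝ} (hm : ∀ x, 0 ≤ m x) {E : Type*} [NormedAddCommGroup E]
    [NormedSpace ℝ E] {F : Ω → E} (hF : ∀ x, Integrable F (P x)) :
    ∫ ω, F ω ∂(lawFrom P m) = ∑ x, m x • ∫ ω, F ω ∂(P x) := by
  rw [lawFrom, integral_finsetSum_measure fun x _ => (hF x).smul_measure ENNReal.ofReal_ne_top]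
  refine Finset.sum_congr rfl fun x _ => ?_
  rw [integral_smul_measure, ENNReal.toReal_ofReal (hm x)]

variable [MeasurableSpace S] [DiscreteMeasurableSpace S] {q : ℝ → S → S → ℝ} {X : ℝ≥0 → Ω → S}

theorem isTransitionFamily_transitionMatrix [DecidableEq S] (hq : IsBoundedRate q)
    (hX : ∀ x, IsMarkovJumpProcess q x (P x) X) :
    IsTransitionFamily q fun t => transitionMatrix P X t.toNNReal where
  isForwardSolution x := (hX x).isForwardSolution hq
  zero := by
    ext x y
    rw [Real.toNNReal_zero]
    exact (hX x).measureReal_zero y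

theorem existsUnique_isInvariantDistribution_transitionMatrix [Nonempty S]
    {r : S → S → ℝ} (hr : IsBoundedRate fun _ => r)
    (hX : ∀ x, IsMarkovJumpProcess (fun _ => r) x (P x) X) (hirr : Irreducible r) :
    ∃! π, ∀ t : ℝ≥0, IsInvariantDistribution (transitionMatrix P X t) π := by
  classical
  have hp := isTransitionFamily_transitionMatrix hr hX
  obtain ⟨π, hπ, huniq⟩ := hp.existsUnique_isInvariantDistribution hr hirr
  refine ⟨π, fun t => ?_, fun ν hν => huniq ν fun t _ => hν t.toNNReal⟩
  simpa only [Real.toNNReal_coe] using hπ t t.coe_nonneg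

theorem meanObservable_eq_sum (hX : ∀ x, IsMarkovJumpProcess q x (P x) X) {m : S → ℝ}
    (hm : ∀ x, 0 ≤ m x) (v : S → ℝ) (t : ℝ≥0) :
    meanObservable P X m v t = ∑ y, Matrix.vecMul m (transitionMatrix P X t) y * v y := by
  have := fun x => (hX x).isProbabilityMeasure
  rw [meanObservable,
    integral_lawFrom hm fun x => integrable_comp_of_finite (P x) ((hX x).measurable t) v]
  simp only [Matrix.vecMul, dotProduct, Finset.sum_mul]
  rw [Finset.sum_comm]
  refine Finset.sum_congr rfl fun x _ => ?_
  rw [integral_comp_eq_sum (P x) ((hX x).measurable t) v, Finset.smul_sum]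
  simp only [transitionMatrix, Matrix.of_apply, smul_eq_mul, mul_assoc]

theorem meanObservable_eq_expectation (hX : ∀ x, IsMarkovJumpProcess q x (P x) X) {m : S → ℝ}
    (hm : ∀ x, 0 ≤ m x) (v : S → ℝ) (t : ℝ≥0) :
    (meanObservable P X m v t : ℂ) =
      expectation (Matrix.vecMul m (transitionMatrix P X t)) fun x => (v x : ℂ) := by
  simp only [meanObservable_eq_sum hX hm, expectation, Complex.ofReal_sum, Complex.ofReal_mul]

theorem meanObservable_add_period (hq : IsBoundedRate q)
    (hX : ∀ x, IsMarkovJumpProcess q x (P x) X) {T : ℝ} (hT : 0 ≤ T)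
    (hper : Function.Periodic q T) {m : S → ℝ}
    (hm : IsInvariantDistribution (transitionMatrix P X T.toNNReal) m) (v : S → ℝ) (t : ℝ≥0) :
    meanObservable P X m v (t + T.toNNReal) = meanObservable P X m v t := by
  classical
  have hp := isTransitionFamily_transitionMatrix hq hX
  have hshift := hp.vecMul_add_eq_of_isInvariantDistribution hq hT hper hm t.coe_nonneg
  rw [Real.toNNReal_add t.coe_nonneg hT, Real.toNNReal_coe] at hshift
  simp only [meanObservable_eq_sum hX hm.1.1, hshift]

theorem intervalIntegrable_meanObservable (hq : IsBoundedRate q)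
    (hX : ∀ x, IsMarkovJumpProcess q x (P x) X) {m : S → ℝ} (hm : m ∈ stdSimplex ℝ S)
    (v : S → ℝ) (a b : ℝ) :
    IntervalIntegrable (fun t => meanObservable P X m v t.toNNReal) volume a b := by
  classical
  have hsol := IsForwardSolution.vecMul hq
    (isTransitionFamily_transitionMatrix hq hX).isForwardSolution hm
  simp only [meanObservable_eq_sum hX hm.1]
  simpa only [Finset.sum_fn] using IntervalIntegrable.sum Finset.univ fun y _ =>
    (hsol.intervalIntegrable y a b).mul_const (v y)

theorem fourierCoefficient_meanObservable (hX : ∀ x, IsMarkovJumpProcess q x (P x) X) {m : S → ℝ}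
    (hm : ∀ x, 0 ≤ m x) (v : S → ℝ) (T : ℝ) (k : ℤ) :
    fourierCoefficient T k (fun t => meanObservable P X m v t.toNNReal) =
      (1 / (T : ℂ)) * ∫ t in (0 : ℝ)..T, Complex.exp (fourierExponent T k * t) *
        expectation (Matrix.vecMul m (transitionMatrix P X t.toNNReal)) fun x => (v x : ℂ) := by
  simp only [fourierCoefficient, fourierExponent, meanObservable_eq_expectation hX hm]

variable [DecidableEq S] {r : S → S → ℝ} {g : ℝ → S → S → ℝ} {π : S → ℝ} {T : ℝ} {k : ℤ}

theorem correlation_eq_psiHatPairing (hr : IsBoundedRate fun _ => r)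
    (hX : ∀ x, IsMarkovJumpProcess (fun _ => r) x (P x) X) (hπ : ∀ x, 0 ≤ π x) (v : S → ℝ)
    {s : ℝ} (hs : 0 ≤ s) :
    correlation P X r g π T k v s = psiHatPairing r g π T k
      ((NormedSpace.exp ((s : ℂ) • twistedGenerator r (fourierExponent T k))).mulVec
        fun x => (v x : ℂ)) := by
  have := fun x => (hX x).isProbabilityMeasure
  have hint : ∀ x, Integrable
      (fun ω => (v (X s.toNNReal ω) : ℂ) * psiHat r g π T k (X 0 ω)) (P x) := fun x =>
    integrable_comp_of_finite (P x) (((hX x).measurable s.toNNReal).prodMk ((hX x).measurable 0))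
      fun a : S × S => (v a.1 : ℂ) * psiHat r g π T k a.2
  have hcond : ∀ x, ∫ ω, (v (X s.toNNReal ω) : ℂ) * psiHat r g π T k (X 0 ω) ∂(P x) =
      (expectation (transitionMatrix P X s.toNNReal x) fun y => (v y : ℂ)) *
        psiHat r g π T k x := fun x => by
    rw [integral_congr_ae ((hX x).start.mono fun ω hω => by simp only [hω]; rfl),
      integral_mul_const,
      integral_comp_eq_sum (P x) ((hX x).measurable s.toNNReal) fun y => (v y : ℂ)]
    rfl
  rw [correlation, integral_lawFrom hπ hint, psiHatPairing_apply, ← fourierExponent,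
    Finset.mul_sum]
  refine Finset.sum_congr rfl fun x _ => ?_
  rw [hcond, (isTransitionFamily_transitionMatrix hr hX).exp_smul_twistedGenerator_mulVec hr _ _ hs,
    Complex.real_smul]
  ring

end MarkovFamily

section FourierResponse

variable {S : Type*} [Fintype S] [DecidableEq S] {r : S → S → ℝ} {g : ℝ → S → S → ℝ} {π : S → ℝ}

namespace IsTransitionFamily

variable {p : ℝ → Matrix S S ℝ}

theorem semigroupPairing_eq_psiHatPairing_centered (hr : IsBoundedRate fun _ => r)
    (hp : IsTransitionFamily (fun _ => r) p) (hirr : Irreducible r)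
    (hπ : IsInvariantDistribution (p 1) π) (hg_meas : ∀ x y, Measurable fun s => g s x y)
    (hg_bdd : ∃ M, ∀ s x y, |g s x y| ≤ M) (T : ℝ) (k : ℤ) (v : S → ℝ) {s : ℝ} (hs : 0 ≤ s) :
    semigroupPairing r g π T k v s = psiHatPairing r g π T k
      ((NormedSpace.exp ((s : ℂ) • twistedGenerator r (fourierExponent T k))).mulVec
        (centered π fun x => (v x : ℂ))) := by
  have hne := fun x => (hp.pos_of_isInvariantDistribution hr hirr one_pos hπ x).ne'
  rw [semigroupPairing_eq_psiHatPairing hr hp v hs,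
    psiHatPairing_exp_smul_mulVec_centered hr hp hne hg_meas hg_bdd _ _ hs]

theorem integrableOn_semigroupPairing (hr : IsBoundedRate fun _ => r)
    (hp : IsTransitionFamily (fun _ => r) p) (hirr : Irreducible r)
    (hπ : IsInvariantDistribution (p 1) π) (hg_meas : ∀ x y, Measurable fun s => g s x y)
    (hg_bdd : ∃ M, ∀ s x y, |g s x y| ≤ M) (T : ℝ) (k : ℤ) (v : S → ℝ) :
    IntegrableOn (semigroupPairing r g π T k v) (Set.Ioi 0) := by
  have hint := hp.integrableOn_exp_smul_mulVec_centered hr hirr hπ (fourierExponent_re T k)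
    fun x => (v x : ℂ)
  refine IntegrableOn.congr_fun ((psiHatPairing r g π T k).integrable_comp hint)
    (fun s hs => ?_) measurableSet_Ioi
  exact (hp.semigroupPairing_eq_psiHatPairing_centered hr hirr hπ hg_meas hg_bdd T k v
    (le_of_lt hs)).symm

theorem integral_semigroupPairing (hr : IsBoundedRate fun _ => r)
    (hp : IsTransitionFamily (fun _ => r) p) (hirr : Irreducible r)
    (hπ : IsInvariantDistribution (p 1) π) (hg_meas : ∀ x y, Measurable fun s => g s x y)
    (hg_bdd : ∃ M, ∀ s x y, |g s x y| ≤ M) (T : ℝ) (k : ℤ) (v : S → ℝ) :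
    ∫ s in Set.Ioi (0 : ℝ), semigroupPairing r g π T k v s =
      psiHatPairing r g π T k (potential r π (fourierExponent T k) fun x => (v x : ℂ)) := by
  rw [setIntegral_congr_fun measurableSet_Ioi fun s hs =>
    hp.semigroupPairing_eq_psiHatPairing_centered hr hirr hπ hg_meas hg_bdd T k v (le_of_lt hs)]
  exact (psiHatPairing r g π T k).integral_comp_comm
    (hp.integrableOn_exp_smul_mulVec_centered hr hirr hπ (fourierExponent_re T k) _)

theorem hasDerivAt_fourierCoefficient (hr : IsBoundedRate fun _ => r)
    (hp : IsTransitionFamily (fun _ => r) p) (hirr : Irreducible r)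
    (hπ : ∀ t, 0 ≤ t → IsInvariantDistribution (p t) π)
    (hg_meas : ∀ x y, Measurable fun s => g s x y) (hg_bdd : ∃ M, ∀ s x y, |g s x y| ≤ M)
    {T : ℝ} (hT : 0 < T) {μ : ℝ → ℝ → S → ℝ}
    (hμ : ∀ lam, IsForwardSolution (perturbedRate r g lam) (μ lam))
    (hper : ∀ lam, μ lam T = μ lam 0) (k : ℤ) (v : S → ℝ) :
    HasDerivAt (fun lam => (1 / (T : ℂ)) * ∫ t in (0 : ℝ)..T,
        Complex.exp (fourierExponent T k * t) * expectation (μ lam t) fun x => (v x : ℂ))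
      (∫ s in Set.Ioi (0 : ℝ), semigroupPairing r g π T k v s) 0 := by
  have hπ₁ := hπ 1 zero_le_one
  have hne := fun x => (hp.pos_of_isInvariantDistribution hr hirr one_pos hπ₁ x).ne'
  obtain ⟨B, hB⟩ := exists_abs_perturbedRate_sub_le r hg_bdd
  rw [hp.integral_semigroupPairing hr hirr hπ₁ hg_meas hg_bdd,
    psiHatPairing_eq_integral hne hg_meas hg_bdd]
  exact (hp.hasDerivAt_integral_cexp_mul_expectation hr hirr hπ
    (isBoundedRate_perturbedRate (hr.nonneg 0) hg_meas hg_bdd) hμ hB (hasDerivAt_perturbedRate r g)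
    hT hper (fourierExponent_re T k) (exp_fourierExponent_mul hT.ne' k) _).const_mul _

end IsTransitionFamily

variable [MeasurableSpace S] [DiscreteMeasurableSpace S]

theorem hasDerivAt_fourierCoefficient_meanObservable {p : ℝ → Matrix S S ℝ}
    (hr : IsBoundedRate fun _ => r) (hp : IsTransitionFamily (fun _ => r) p) (hirr : Irreducible r)
    (hπ : ∀ t, 0 ≤ t → IsInvariantDistribution (p t) π) {T : ℝ} (hT : 0 < T)
    (hg_per : ∀ x y, Function.Periodic (fun s => g s x y) T)
    (hg_meas : ∀ x y, Measurable fun s => g s x y) (hg_bdd : ∃ M, ∀ s x y, |g s x y| ≤ M)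
    {Ω : ℝ → Type*} [∀ lam, MeasurableSpace (Ω lam)] {X : ∀ lam, ℝ≥0 → Ω lam → S}
    {P : ∀ lam, S → Measure (Ω lam)}
    (hX : ∀ lam x, IsMarkovJumpProcess (perturbedRate r g lam) x (P lam x) (X lam))
    {πl : ℝ → S → ℝ}
    (hπl : ∀ lam, IsInvariantDistribution (transitionMatrix (P lam) (X lam) T.toNNReal) (πl lam))
    (k : ℤ) (v : S → ℝ) :
    HasDerivAt (fun lam => fourierCoefficient T k fun t =>
        meanObservable (P lam) (X lam) (πl lam) v t.toNNReal)
      (∫ s in Set.Ioi (0 : ℝ), semigroupPairing r g π T k v s) 0 := by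
  have hq := isBoundedRate_perturbedRate (hr.nonneg 0) hg_meas hg_bdd
  have hq_trans := fun lam => isTransitionFamily_transitionMatrix (hq lam) (hX lam)
  have hμ := fun lam => IsForwardSolution.vecMul (hq lam) (hq_trans lam).isForwardSolution
    (hπl lam).1
  have hμ_per := fun lam => (hq_trans lam).vecMul_add_eq_of_isInvariantDistribution (hq lam) hT.le
    (perturbedRate_periodic hg_per lam) (hπl lam) le_rfl
  simp only [zero_add] at hμ_per
  simpa only [fourierCoefficient_meanObservable (hX _) (hπl _).1.1] using
    hp.hasDerivAt_fourierCoefficient hr hirr hπ hg_meas hg_bdd hT hμ hμ_per k v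

variable {Ω : Type*} [MeasurableSpace Ω] {P : S → Measure Ω} {X : ℝ≥0 → Ω → S}

theorem correlation_eq_semigroupPairing (hr : IsBoundedRate fun _ => r)
    (hX : ∀ x, IsMarkovJumpProcess (fun _ => r) x (P x) X) (hπ : ∀ x, 0 ≤ π x) (T : ℝ) (k : ℤ)
    (v : S → ℝ) {s : ℝ} (hs : 0 ≤ s) :
    correlation P X r g π T k v s = semigroupPairing r g π T k v s := by
  rw [correlation_eq_psiHatPairing hr hX hπ v hs,
    semigroupPairing_eq_psiHatPairing hr (isTransitionFamily_transitionMatrix hr hX) v hs]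

end FourierResponse

end JumpLR

theorem mainTheorem8 {S : Type*} [Fintype S] [DecidableEq S] [Nonempty S]
    [MeasurableSpace S] [DiscreteMeasurableSpace S]
    (r : S → S → ℝ) (hr : ∀ x y, 0 ≤ r x y) (hirr : JumpLR.Irreducible r)
    (T : ℝ) (hT : 0 < T)
    (g : ℝ → S → S → ℝ) (hg_per : ∀ x y, Function.Periodic (fun s => g s x y) T)
    (hg_meas : ∀ x y, Measurable (fun s => g s x y))
    (hg_bdd : ∃ M : ℝ, ∀ s x y, |g s x y| ≤ M)
    -- for each `lam`, the perturbed process `X lam` and its laws `P lam x`, started at `x`;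
    -- `lam = 0` is the unperturbed process
    {Ω : ℝ → Type*} [∀ lam, MeasurableSpace (Ω lam)]
    (X : ∀ lam, ℝ≥0 → Ω lam → S) (P : ∀ lam, S → Measure (Ω lam))
    (hX : ∀ lam x, JumpLR.IsMarkovJumpProcess (JumpLR.perturbedRate r g lam) x
      (P lam x) (X lam)) :
    -- existence and uniqueness of the invariant distribution `π` of the unperturbed process
    (∃! π : S → ℝ, ∀ t : ℝ≥0,
      JumpLR.IsInvariantDistribution (JumpLR.transitionMatrix (P 0) (X 0) t) π) ∧
    -- existence and uniqueness of the invariant distribution `π_lam` of `(X lam (n T))_n`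
    (∀ lam : ℝ, ∃! π : S → ℝ, JumpLR.IsInvariantDistribution
      (JumpLR.transitionMatrix (P lam) (X lam) T.toNNReal) π) ∧
    ∀ (π : S → ℝ) (πl : ℝ → S → ℝ),
      (∀ t : ℝ≥0, JumpLR.IsInvariantDistribution
        (JumpLR.transitionMatrix (P 0) (X 0) t) π) →
      (∀ lam : ℝ, JumpLR.IsInvariantDistribution
        (JumpLR.transitionMatrix (P lam) (X lam) T.toNNReal) (πl lam)) →
      ∀ v : S → ℝ,
        (∀ (lam : ℝ) (t : ℝ≥0),
          JumpLR.meanObservable (P lam) (X lam) (πl lam) v (t + T.toNNReal) =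
            JumpLR.meanObservable (P lam) (X lam) (πl lam) v t) ∧
        (∀ lam : ℝ, IntervalIntegrable
          (fun t : ℝ => JumpLR.meanObservable (P lam) (X lam) (πl lam) v t.toNNReal)
          volume 0 T) ∧
        ∀ k : ℤ,
          IntegrableOn (JumpLR.semigroupPairing r g π T k v) (Set.Ioi 0) ∧
          IntegrableOn (JumpLR.correlation (P 0) (X 0) r g π T k v) (Set.Ioi 0) ∧
          HasDerivAt
            (fun lam : ℝ => JumpLR.fourierCoefficient T k
              (fun t => JumpLR.meanObservable (P lam) (X lam) (πl lam) v t.toNNReal))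
            (∫ s in Set.Ioi (0 : ℝ), JumpLR.semigroupPairing r g π T k v s) 0 ∧
          ∫ s in Set.Ioi (0 : ℝ), JumpLR.semigroupPairing r g π T k v s =
            ∫ s in Set.Ioi (0 : ℝ), JumpLR.correlation (P 0) (X 0) r g π T k v s := by
  have hrate : JumpLR.perturbedRate r g 0 = fun _ => r := funext (JumpLR.perturbedRate_zero r g)
  have hq := JumpLR.isBoundedRate_perturbedRate hr hg_meas hg_bdd
  have hp := fun lam => JumpLR.isTransitionFamily_transitionMatrix (hq lam) (hX lam)
  have hr₀ : JumpLR.IsBoundedRate fun _ => r := hrate ▸ hq 0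
  have hX₀ : ∀ x, JumpLR.IsMarkovJumpProcess (fun _ => r) x (P 0 x) (X 0) := hrate ▸ hX 0
  have hp₀ := JumpLR.isTransitionFamily_transitionMatrix hr₀ hX₀
  refine ⟨JumpLR.existsUnique_isInvariantDistribution_transitionMatrix hr₀ hX₀ hirr, fun lam => ?_,
    fun π πl hπ hπl v => ⟨fun lam => ?_, fun lam => ?_, fun k => ?_⟩⟩
  · exact JumpLR.existsUnique_isInvariantDistribution ((hp lam).mem_stdSimplex T)
      ((hp lam).pos_of_irreducible (hq lam) hirr
        (fun s _ _ h => JumpLR.perturbedRate_pos h lam s) hT)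
  · exact JumpLR.meanObservable_add_period (hq lam) (hX lam) hT.le
      (JumpLR.perturbedRate_periodic hg_per lam) (hπl lam) v
  · exact JumpLR.intervalIntegrable_meanObservable (hq lam) (hX lam) (hπl lam).1 v 0 T
  · have hπ' := fun (t : ℝ) (_ : 0 ≤ t) => hπ t.toNNReal
    have hint := hp₀.integrableOn_semigroupPairing hr₀ hirr (hπ' 1 zero_le_one) hg_meas hg_bdd T k v
    have hcorr : Set.EqOn (JumpLR.semigroupPairing r g π T k v)
        (JumpLR.correlation (P 0) (X 0) r g π T k v) (Set.Ioi 0) := fun s hs =>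
      (JumpLR.correlation_eq_semigroupPairing hr₀ hX₀ (hπ 0).1.1 T k v (le_of_lt hs)).symm
    exact ⟨hint, hint.congr_fun hcorr measurableSet_Ioi,
      JumpLR.hasDerivAt_fourierCoefficient_meanObservable hr₀ hp₀ hirr hπ' hT hg_per hg_meas hg_bdd
        hX hπl k v, setIntegral_congr_fun measurableSet_Ioi hcorr⟩
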